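/- Let $G$ be a locally compact Hausdorff group with identity $e$. For $f\in C_b(G)$ write $(\Delta f)(p,q)=f(pq)$ and $\check f(p)=f(p^{-1})$. Let $P\colon C_b(G)\to C_b(G)$ be a conditional expectation onto its range, i.e. a bounded linear map whose range $R$ is a $C^*$-subalgebra of $C_b(G)$, with $P^2=P$, $\|P\|=1$, $P(f^*f)\ge 0$, $P(b_1fb_2)=b_1P(f)b_2$ for $b_1,b_2\in R$, and $P(f^*)P(f)\le P(f^*f)$. Assume that for every $f\ge 0$ in the space $C_c(G)$ of compactly supported continuous functions, $P(f)$ is nonnegative and compactly supported and $P(f)(p)>0$ whenever $f(p)>0$. Assume further that for all $f\in C_b(G)$ $$(P\times \mathrm{id})\Delta(Pf)=(\mathrm{id}\times P)\Delta(Pf)=(P\times P)\Delta f,\qquad P(\check f)=(Pf)\check{\ },$$ where $P\times\mathrm{id}$ and $\mathrm{id}\times P$ apply $P$ in the first, respectively the second, variable of a function in $C_b(G\times G)$ and $P\times P$ is their composition. Let $B=P(C_0(G))$, a commutative $C^*$-algebra, let $Q$ be its Gelfand spectrum, and let $\varphi\colon G\to Q$ be the continuous map $\varphi(p)(b)=b(p)$,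 $b\in B$. Let $\tilde e=\varphi(e)$ and, for $s\in Q$, let $\check s\in Q$ be given by $\check s(b)=s(\check b)$, $b\in B$. Then $\varphi$ is surjective, and there is a (necessarily unique) linear map $\tilde\Delta\colon C_b(Q)\to C_b(Q\times Q)$ such that, identifying functions on $Q$ with functions on $G$ via $\varphi$, $\tilde\Delta=(P\times P)\circ\Delta$, that is, $$(\tilde\Delta f)(\varphi(p),\varphi(q))=\bigl((P\times P)\Delta(f\circ\varphi)\bigr)(p,q),\qquad f\in C_b(Q),\ p,q\in G.$$ There is a bilinear product $*$ on the space $M_b(Q)$ of bounded complex Radon measures on $Q$ such that $$\int f\,d(\mu*\nu)=\int\!\!\int (\tilde\Delta f)(s,t)\,d\nu(t)\,d\mu(s),\qquad f\in C_b(Q),\ \mu,\nu\in M_b(Q),$$ in particular $\int f\,d(\varepsilon_s*\varepsilon_t)=(\tilde\Delta f)(s,t)$ for the Dirac measures $\varepsilon_s,\varepsilon_t$, and $(Q,*,\tilde e,\check{\ })$ is a locally compact (DJS) hypergroup: $Q$ is a locally compact Hausdorff space, and 1. $(M_b(Q),*)$ is an associative algebra; 2. $\varepsilon_s*\varepsilon_t$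 is a probability measure with compact support for all $s,t\in Q$; 3. $(s,t)\mapsto\varepsilon_s*\varepsilon_t$ is continuous for the topology $\sigma(M_b(Q),C_0(Q))$; 4. $(s,t)\mapsto\operatorname{supp}(\varepsilon_s*\varepsilon_t)$ is continuous for the Michael topology on the nonempty compact subsets of $Q$ (generated by the sets $\{F: F\subset W,\ F\cap V\ne\emptyset\}$, $V,W\subset Q$ open); 5. $\varepsilon_{\tilde e}*\varepsilon_s=\varepsilon_s*\varepsilon_{\tilde e}=\varepsilon_s$ for all $s$; 6. $s\mapsto\check s$ is a homeomorphism of $Q$ with $\check{\check s}=s$, and the image of $\varepsilon_s*\varepsilon_t$ under it is $\varepsilon_{\check t}*\varepsilon_{\check s}$; 7. $\tilde e\in\operatorname{supp}(\varepsilon_s*\varepsilon_t)$ if and only if $s=\check t$. If moreover $m$ is a left Haar measure on $G$ with $\int P(f)\,dm=\int f\,dm$ for all $f\in C_c(G)$, then the image measure $\tilde m=\varphi_*(m)$ is a left Haar measure on $Q$: it is a nonzero positive Radon measure with $\varepsilon_s*\tilde m=\tilde m$ for all $s\in Q$, i.e. $\int\bigl(\int f\,d(\varepsilon_s*\varepsilon_t)\bigr)\,d\tilde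 m(t)=\int f\,d\tilde m$ for all compactly supported continuous $f$ on $Q$. -/

import Mathlib

open MeasureTheory Filter Topology
open scoped BoundedContinuousFunction ZeroAtInfty ComplexOrder

set_option linter.unusedSectionVars false

noncomputable section

/-! ### Bounded Radon measures and hypergroups -/

namespace Hypergroup

variable {Q : Type*} [TopologicalSpace Q]

/-- Bounded complex Radon measures on `Q` in the sense of Bourbaki: bounded linear functionals on
`C₀(Q)` (equivalently, functionals on the compactly supported functions that are bounded for the
sup norm). The norm is the total mass `sup {|μ f| : ‖f‖ ≤ 1}`. -/
abbrev BoundedMeasure (Q : Type*) [TopologicalSpace Q] : Type _ := C₀(Q, ℂ) →L[ℂ] ℂ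

/-- The Dirac measure at `s`. -/
def dirac (s : Q) : BoundedMeasure Q :=
  LinearMap.mkContinuous
    { toFun := fun f => f s
      map_add' := fun _ _ => rfl
      map_smul' := fun _ _ => rfl } 1
    (fun f => by simpa using f.toBCF.norm_coe_le_norm s)

/-- The support of a bounded measure: `x` lies in it iff `μ` does not vanish on any
neighbourhood of `x`. -/
def supp (μ : BoundedMeasure Q) : Set Q :=
  {x | ∀ U ∈ 𝓝 x, ∃ f : C₀(Q, ℂ), (∀ y, y ∉ U → f y = 0) ∧ μ f ≠ 0}

/-- `μ` is a probability measure: it is nonnegative and has total mass one. -/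
def IsProbability (μ : BoundedMeasure Q) : Prop :=
  (∀ f : C₀(Q, ℂ), (∀ x, 0 ≤ f x) → 0 ≤ μ f) ∧ ‖μ‖ = 1

/-- The image of a bounded measure under a homeomorphism: `f ↦ μ (f ∘ σ)`. -/
def mapHomeo (σ : Q ≃ₜ Q) (μ : BoundedMeasure Q) : BoundedMeasure Q :=
  LinearMap.mkContinuous
    { toFun := fun f => μ (f.comp σ.toCocompactMap)
      map_add' := fun f g => by rw [← map_add]; rfl
      map_smul' := fun c f => by rw [RingHom.id_apply, ← map_smul]; rfl } ‖μ‖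
    (fun f => by
      refine (μ.le_opNorm _).trans (mul_le_mul_of_nonneg_left ?_ (norm_nonneg _))
      rw [← ZeroAtInftyContinuousMap.norm_toBCF_eq_norm]
      exact (BoundedContinuousFunction.norm_le (norm_nonneg f)).2
        fun x => f.toBCF.norm_coe_le_norm (σ x))

/-- The product of a bounded continuous function with a function vanishing at infinity. -/
def cutoff (χ : C₀(Q, ℂ)) (g : Q →ᵇ ℂ) : C₀(Q, ℂ) where
  toFun x := χ x * g x
  continuous_toFun := χ.continuous.mul g.continuous
  zero_at_infty' := by
    refine squeeze_zero_norm (a := fun x => ‖χ x‖ * ‖g‖) (fun x => ?_) ?_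
    · rw [norm_mul]
      exact mul_le_mul_of_nonneg_left (g.norm_coe_le_norm x) (norm_nonneg _)
    · simpa using (χ.zero_at_infty'.norm.mul_const ‖g‖)

/-- `HasIntegral μ g c`: the integral of the bounded continuous function `g` against the bounded
measure `μ` is `c`, that is, `μ (χ g)` tends to `c` as the cutoff functions `χ ∈ C₀(Q)`,
`0 ≤ χ ≤ 1`, become one on larger and larger compact sets. -/
def HasIntegral (μ : BoundedMeasure Q) (g : Q →ᵇ ℂ) (c : ℂ) : Prop :=
  ∀ ε : ℝ, 0 < ε → ∃ K : Set Q, IsCompact K ∧ ∀ χ : C₀(Q, ℂ), (∀ x, 0 ≤ χ x ∧ χ x ≤ 1) →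
    (∀ x ∈ K, χ x = 1) → ‖μ (cutoff χ g) - c‖ ≤ ε

/-- The section `t ↦ F (s, t)` of a bounded continuous function of two variables. -/
def sectionRight {X Y : Type*} [TopologicalSpace X] [TopologicalSpace Y]
    (F : X × Y →ᵇ ℂ) (s : X) : Y →ᵇ ℂ :=
  F.compContinuous ⟨fun t => (s, t), by fun_prop⟩

/-- The section `s ↦ F (s, t)` of a bounded continuous function of two variables. -/
def sectionLeft {X Y : Type*} [TopologicalSpace X] [TopologicalSpace Y]
    (F : X × Y →ᵇ ℂ) (t : Y) : X →ᵇ ℂ :=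
  F.compContinuous ⟨fun s => (s, t), by fun_prop⟩

/-- `(Q, mul, e, inv)` is a locally compact (DJS) hypergroup, where the bilinear map `mul` is the
convolution of bounded Radon measures on `Q`. -/
structure IsHypergroup (mul : BoundedMeasure Q →ₗ[ℂ] BoundedMeasure Q →ₗ[ℂ] BoundedMeasure Q)
    (e : Q) (inv : Q ≃ₜ Q) : Prop where
  locallyCompact : LocallyCompactSpace Q
  hausdorff : T2Space Q
  /-- the bounded measures form an associative algebra -/
  assoc : ∀ μ ν ρ, mul (mul μ ν) ρ = mul μ (mul ν ρ)
  /-- convolutions of point masses are probability measures -/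
  isProbability : ∀ s t, IsProbability (mul (dirac s) (dirac t))
  /-- weak continuity of `(s, t) ↦ ε_s * ε_t` -/
  continuous_mul : ∀ f : C₀(Q, ℂ), Continuous fun x : Q × Q => mul (dirac x.1) (dirac x.2) f
  /-- `(s, t) ↦ supp (ε_s * ε_t)` takes values in the nonempty compact sets and is continuous for
  the Michael topology, which is the Vietoris topology that Mathlib puts on this type -/
  continuous_supp : ∃ S : Q × Q → TopologicalSpace.NonemptyCompacts Q,
    (∀ s t, (S (s, t) : Set Q) = supp (mul (dirac s) (dirac t))) ∧ Continuous S
  one_mul : ∀ s, mul (dirac e) (dirac s) = dirac s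
  mul_one : ∀ s, mul (dirac s) (dirac e) = dirac s
  inv_inv : ∀ s, inv (inv s) = s
  map_inv : ∀ s t,
    mapHomeo inv (mul (dirac s) (dirac t)) = mul (dirac (inv t)) (dirac (inv s))
  mem_supp_iff : ∀ s t, e ∈ supp (mul (dirac s) (dirac t)) ↔ s = inv t

/-- `D` is the comultiplication of the convolution `mul`: for every `f ∈ C_b(Q)` one has
`⟨f, ε_s * ε_t⟩ = (D f)(s, t)` for all points `s, t`, and
`⟨f, μ * ν⟩ = ∫ (∫ (D f)(s, t) dν(t)) dμ(s)` for all bounded measures `μ, ν`. -/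
def IsComultiplication
    (mul : BoundedMeasure Q →ₗ[ℂ] BoundedMeasure Q →ₗ[ℂ] BoundedMeasure Q)
    (D : (Q →ᵇ ℂ) →ₗ[ℂ] (Q × Q →ᵇ ℂ)) : Prop :=
  (∀ f s t, HasIntegral (mul (dirac s) (dirac t)) f (D f (s, t))) ∧
  ∀ f μ ν, ∃ (g : Q →ᵇ ℂ) (c : ℂ), (∀ s, HasIntegral ν (sectionRight (D f) s) (g s)) ∧
    HasIntegral μ g c ∧ HasIntegral (mul μ ν) f c

/-- `m` is a left Haar measure for the convolution `mul`: a nonzero (positive) Radon measure with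
`ε_s * m = m` for all `s`, i.e. `∫ ⟨f, ε_s * ε_t⟩ dm(t) = ∫ f dm` for compactly supported `f`. -/
structure IsLeftHaarMeasure [MeasurableSpace Q] [BorelSpace Q]
    (mul : BoundedMeasure Q →ₗ[ℂ] BoundedMeasure Q →ₗ[ℂ] BoundedMeasure Q)
    (m : Measure Q) : Prop where
  regular : m.Regular
  ne_zero : m ≠ 0
  invariant : ∀ (s : Q) (f : C₀(Q, ℂ)), HasCompactSupport f →
    Integrable (fun t => mul (dirac s) (dirac t) f) m ∧
      ∫ t, mul (dirac s) (dirac t) f ∂m = ∫ t, f t ∂m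

end Hypergroup

/-! ### Conditional expectations on `C_b(G)` -/

namespace CondExpectation

open Hypergroup

/-- `P` is a conditional expectation of the C⋆-algebra `C_b(X)` onto its range, which is a
C⋆-subalgebra (it is automatically closed, as `P` is continuous and idempotent). -/
structure IsConditionalExpectation {X : Type*} [TopologicalSpace X]
    (P : (X →ᵇ ℂ) →L[ℂ] (X →ᵇ ℂ)) : Prop where
  mul_mem_range : ∀ f g, P f * P g ∈ Set.range P
  star_mem_range : ∀ f, star (P f) ∈ Set.range P
  idem : ∀ f, P (P f) = P f
  norm_eq_one : ‖P‖ = 1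
  nonneg : ∀ f x, 0 ≤ P (star f * f) x
  bimodule : ∀ b₁ ∈ Set.range P, ∀ b₂ ∈ Set.range P, ∀ f, P (b₁ * f * b₂) = b₁ * P f * b₂
  schwarz : ∀ f x, (P (star f) * P f) x ≤ P (star f * f) x

/-- `P` maps nonnegative compactly supported functions to such functions, and `P f` is strictly
positive wherever such an `f` is. -/
structure PreservesCompactPositivity {X : Type*} [TopologicalSpace X]
    (P : (X →ᵇ ℂ) →L[ℂ] (X →ᵇ ℂ)) : Prop where
  nonneg : ∀ f : X →ᵇ ℂ, (∀ x, 0 ≤ f x) → HasCompactSupport f → ∀ x, 0 ≤ P f x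
  hasCompactSupport : ∀ f : X →ᵇ ℂ, (∀ x, 0 ≤ f x) → HasCompactSupport f →
    HasCompactSupport (P f)
  pos : ∀ f : X →ᵇ ℂ, (∀ x, 0 ≤ f x) → HasCompactSupport f → ∀ x, 0 < f x → 0 < P f x

section Helpers

variable {X : Type*} [TopologicalSpace X] {P : (X →ᵇ ℂ) →L[ℂ] (X →ᵇ ℂ)}

theorem IsConditionalExpectation.map_mul (hP : IsConditionalExpectation P) (g f : X →ᵇ ℂ) :
    P (P g * f) = P g * P f := by
  obtain ⟨h₁, e₁⟩ := hP.mul_mem_range g f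
  set d := P (P g * f) - P g * P f with hd
  have hdr : d ∈ Set.range P := ⟨P g * f - h₁, by rw [map_sub, e₁]⟩
  have hsr : star d ∈ Set.range P := by
    obtain ⟨u, hu⟩ := hdr
    rw [← hu]
    exact hP.star_mem_range u
  have hgr : star d * P g ∈ Set.range P := by
    obtain ⟨u, hu⟩ := hsr
    rw [← hu]
    exact hP.mul_mem_range u g
  have e₂ := hP.bimodule _ hsr _ hsr (P g * f)
  have e₃ := hP.bimodule _ hgr _ hsr f
  have e₄ : star d * (P g * f) * star d = star d * P g * f * star d := by ring
  rw [e₄, e₃] at e₂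
  have e₅ : star d * d * star d = 0 := by
    rw [hd]
    rw [hd] at e₂
    linear_combination -e₂
  have e₆ : d = 0 := by
    ext x
    have := congrArg (fun h : X →ᵇ ℂ => h x) e₅
    simpa using this
  exact sub_eq_zero.1 e₆

theorem IsConditionalExpectation.nonneg_of_nonneg (hP : IsConditionalExpectation P)
    (f : X →ᵇ ℂ) (hf : ∀ x, 0 ≤ f x) (x : X) : 0 ≤ P f x := by
  let g : X →ᵇ ℂ := BoundedContinuousFunction.ofNormedAddCommGroup
    (fun x => ((Real.sqrt (f x).re : ℝ) : ℂ)) (by fun_prop) (Real.sqrt ‖f‖) (fun x => by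
      rw [Complex.norm_real, Real.norm_of_nonneg (Real.sqrt_nonneg _)]
      exact Real.sqrt_le_sqrt ((Complex.re_le_norm _).trans (f.norm_coe_le_norm x)))
  have hg : star g * g = f := by
    ext y
    obtain ⟨h1, h2⟩ := Complex.nonneg_iff.1 (hf y)
    have : (star g * g) y
        = (starRingEnd ℂ) ((Real.sqrt (f y).re : ℝ) : ℂ) * ((Real.sqrt (f y).re : ℝ) : ℂ) := rfl
    rw [this, Complex.conj_ofReal, ← Complex.ofReal_mul, Real.mul_self_sqrt h1]
    exact Complex.ext (by simp) (by simpa using h2)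
  rw [← hg]
  exact hP.nonneg g x

theorem IsConditionalExpectation.star_apply_of_real (hP : IsConditionalExpectation P)
    (f : X →ᵇ ℂ) (hf : star f = f) : star (P f) = P f := by
  let c : X →ᵇ ℂ := BoundedContinuousFunction.const X ((‖f‖ : ℝ) : ℂ)
  have him : ∀ x, (f x).im = 0 := fun x => by
    have h := congrArg (fun h : X →ᵇ ℂ => (h x)) hf
    exact Complex.conj_eq_iff_im.1 h
  have h1 : ∀ x, 0 ≤ (c + f) x := fun x => by
    rw [Complex.nonneg_iff]
    have h2 := (abs_le.1 ((Complex.abs_re_le_norm _).trans (f.norm_coe_le_norm x))).1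
    refine ⟨?_, ?_⟩
    · simp [c]; linarith
    · simp [c, him]
  have h2 : ∀ x, 0 ≤ c x := fun x => by simp [c]
  have h3 : P f = P (c + f) - P c := by rw [map_add]; abel
  ext x
  have e1 := (Complex.nonneg_iff.1 (hP.nonneg_of_nonneg _ h1 x)).2
  have e2 := (Complex.nonneg_iff.1 (hP.nonneg_of_nonneg _ h2 x)).2
  refine Complex.conj_eq_iff_im.2 ?_
  rw [h3]
  simp only [BoundedContinuousFunction.coe_sub, Pi.sub_apply, Complex.sub_im]
  rw [← e1, ← e2, sub_zero]

theorem IsConditionalExpectation.map_star (hP : IsConditionalExpectation P) (f : X →ᵇ ℂ) :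
    P (star f) = star (P f) := by
  have h1 := hP.star_apply_of_real (f + star f) (by rw [star_add, star_star, add_comm])
  have h2 := hP.star_apply_of_real (Complex.I • (f - star f)) (by
    rw [star_smul, star_sub, star_star, RCLike.star_def, Complex.conj_I]
    module)
  rw [map_add, star_add] at h1
  rw [map_smul, star_smul, map_sub, star_sub, RCLike.star_def, Complex.conj_I] at h2
  ext x
  have e1 := congrArg (fun h : X →ᵇ ℂ => h x) h1
  have e2 := congrArg (fun h : X →ᵇ ℂ => h x) h2
  simp only [BoundedContinuousFunction.coe_add, Pi.add_apply, BoundedContinuousFunction.coe_smul,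
    BoundedContinuousFunction.coe_sub, Pi.sub_apply, smul_eq_mul] at e1 e2
  have e3 : -(star (P f) x - star (P (star f)) x) = P f x - P (star f) x :=
    mul_left_cancel₀ Complex.I_ne_zero (by linear_combination e2)
  linear_combination (-1 / 2 : ℂ) * e1 + (1 / 2 : ℂ) * e3

theorem PreservesCompactPositivity.exists_pos [LocallyCompactSpace X] [T2Space X]
    (hK : PreservesCompactPositivity P) (x : X) :
    ∃ k : X →ᵇ ℂ, HasCompactSupport k ∧ HasCompactSupport (P k) ∧ P k x ≠ 0 := by
  obtain ⟨f, hc, h0, hx⟩ := exists_continuous_nonneg_pos x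
  obtain ⟨C, hC⟩ := hc.exists_bound_of_continuous f.continuous
  let k : X →ᵇ ℂ := BoundedContinuousFunction.ofNormedAddCommGroup
    (fun x => ((f x : ℝ) : ℂ)) (by fun_prop) C (fun x => by simpa using hC x)
  have hkc : HasCompactSupport k := hc.comp_left (g := fun r : ℝ => (r : ℂ)) (by simp)
  have hk0 : ∀ y, 0 ≤ k y := fun y => Complex.zero_le_real.2 (h0 y)
  have hkx : 0 < k x := Complex.zero_lt_real.2 (lt_of_le_of_ne (h0 x) hx.symm)
  exact ⟨k, hkc, hK.hasCompactSupport k hk0 hkc, (hK.pos k hk0 hkc x hkx).ne'⟩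

theorem continuous_mul_section {Y : Type*} [TopologicalSpace Y] (F : Y × X →ᵇ ℂ) (b : X →ᵇ ℂ)
    (hb : HasCompactSupport b) : Continuous fun y : Y => b * sectionRight F y := by
  rw [continuous_iff_continuousAt]
  intro y₀
  have hcur : Tendsto (fun y => F.toContinuousMap.curry y) (𝓝 y₀)
      (𝓝 (F.toContinuousMap.curry y₀)) := F.toContinuousMap.curry.continuous.tendsto y₀
  have hu := ContinuousMap.tendsto_iff_forall_isCompact_tendstoUniformlyOn.1 hcur _ hb
  rw [Metric.tendstoUniformlyOn_iff] at hu
  rw [ContinuousAt, Metric.tendsto_nhds]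
  intro ε hε
  have hpos : 0 < ‖b‖ + 1 := by positivity
  filter_upwards [hu (ε / 2 / (‖b‖ + 1)) (by positivity)] with y hy
  refine lt_of_le_of_lt ?_ (half_lt_self hε)
  refine (BoundedContinuousFunction.dist_le (by positivity)).2 fun x => ?_
  have e : dist ((b * sectionRight F y) x) ((b * sectionRight F y₀) x)
      = ‖b x‖ * dist (F (y₀, x)) (F (y, x)) := by
    rw [dist_comm, dist_eq_norm, dist_eq_norm, ← norm_mul, mul_sub]
    rfl
  rw [e]
  by_cases hx : x ∈ tsupport b
  · have h1 : dist (F (y₀, x)) (F (y, x)) < ε / 2 / (‖b‖ + 1) := hy x hx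
    have h2 : ‖b x‖ ≤ ‖b‖ + 1 := (b.norm_coe_le_norm x).trans (by linarith)
    calc ‖b x‖ * dist (F (y₀, x)) (F (y, x)) ≤ (‖b‖ + 1) * (ε / 2 / (‖b‖ + 1)) :=
          mul_le_mul h2 h1.le dist_nonneg hpos.le
      _ = ε / 2 := by field_simp
  · rw [image_eq_zero_of_notMem_tsupport hx]
    simp only [norm_zero, zero_mul]
    positivity

theorem continuous_slice [LocallyCompactSpace X] [T2Space X] {Y : Type*} [TopologicalSpace Y]
    (hP : IsConditionalExpectation P) (hK : PreservesCompactPositivity P) (F : Y × X →ᵇ ℂ) :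
    Continuous fun z : Y × X => P (sectionRight F z.1) z.2 := by
  rw [continuous_iff_continuousAt]
  rintro ⟨y₀, x₀⟩
  obtain ⟨k, -, hPk, hne⟩ := hK.exists_pos x₀
  have h1 : Continuous fun z : Y × X => P (P k * sectionRight F z.1) z.2 := by
    have h2 : Continuous fun z : Y × X => P (P k * sectionRight F z.1) :=
      P.continuous.comp ((continuous_mul_section F (P k) hPk).comp continuous_fst)
    exact h2.eval continuous_snd
  have h3 : Continuous fun z : Y × X => P k z.2 := (P k).continuous.comp continuous_snd
  have h4 : ContinuousAt (fun z : Y × X => P (P k * sectionRight F z.1) z.2 / P k z.2) (y₀, x₀) :=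
    h1.continuousAt.div h3.continuousAt hne
  refine h4.congr ?_
  filter_upwards [h3.continuousAt.eventually_ne hne] with z hz
  rw [hP.map_mul]
  simp only [BoundedContinuousFunction.coe_mul, Pi.mul_apply]
  field_simp

end Helpers

section Main

variable {G : Type*} [TopologicalSpace G] [LocallyCompactSpace G] [T2Space G]
  {P : (G →ᵇ ℂ) →L[ℂ] (G →ᵇ ℂ)}

/-- The map `id × P` on `C_b(G × G)`: apply `P` in the second variable. -/
def idTensor (hP : IsConditionalExpectation P) (hK : PreservesCompactPositivity P)
    (F : G × G →ᵇ ℂ) : G × G →ᵇ ℂ :=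
  BoundedContinuousFunction.ofNormedAddCommGroup
    (fun z => P (sectionRight F z.1) z.2) (continuous_slice hP hK F) ‖F‖ (fun z => by
      refine ((P (sectionRight F z.1)).norm_coe_le_norm z.2).trans ?_
      refine (P.le_opNorm _).trans ?_
      rw [hP.norm_eq_one, one_mul]
      exact (BoundedContinuousFunction.norm_le (norm_nonneg _)).2
        fun x => F.norm_coe_le_norm (z.1, x))

/-- The flip of the two variables. -/
def swapVars (F : G × G →ᵇ ℂ) : G × G →ᵇ ℂ := F.compContinuous ⟨Prod.swap, continuous_swap⟩

/-- The map `P × id` on `C_b(G × G)`: apply `P` in the first variable. -/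
def tensorId (hP : IsConditionalExpectation P) (hK : PreservesCompactPositivity P)
    (F : G × G →ᵇ ℂ) : G × G →ᵇ ℂ :=
  swapVars (idTensor hP hK (swapVars F))

theorem idTensor_apply (hP : IsConditionalExpectation P) (hK : PreservesCompactPositivity P)
    (F : G × G →ᵇ ℂ) (p q : G) : idTensor hP hK F (p, q) = P (sectionRight F p) q := rfl

theorem tensorId_apply (hP : IsConditionalExpectation P) (hK : PreservesCompactPositivity P)
    (F : G × G →ᵇ ℂ) (p q : G) : tensorId hP hK F (p, q) = P (sectionLeft F q) p := rfl

/-- The map `P × P = (P × id) ∘ (id × P)` on `C_b(G × G)`. -/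
def tensor (hP : IsConditionalExpectation P) (hK : PreservesCompactPositivity P)
    (F : G × G →ᵇ ℂ) : G × G →ᵇ ℂ :=
  tensorId hP hK (idTensor hP hK F)

/-- The group comultiplication `(Δ f)(p, q) = f (p q)`. -/
def comul [Group G] [IsTopologicalGroup G] (f : G →ᵇ ℂ) : G × G →ᵇ ℂ :=
  f.compContinuous ⟨fun z => z.1 * z.2, by fun_prop⟩

/-- The function `p ↦ f (p⁻¹)`. -/
def check [Group G] [IsTopologicalGroup G] (f : G →ᵇ ℂ) : G →ᵇ ℂ :=
  f.compContinuous ⟨fun p => p⁻¹, by fun_prop⟩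

/-- The C⋆-algebra `B = P(C₀(G))`, inside `C_b(G)`. -/
def baseAlgebra (hP : IsConditionalExpectation P) : NonUnitalStarSubalgebra ℂ (G →ᵇ ℂ) where
  carrier := {b | ∃ f : G →ᵇ ℂ, Tendsto f (cocompact G) (𝓝 0) ∧ P f = b}
  zero_mem' := ⟨0, tendsto_const_nhds, map_zero P⟩
  add_mem' := by
    rintro _ _ ⟨f, hf, rfl⟩ ⟨g, hg, rfl⟩
    refine ⟨f + g, ?_, map_add P f g⟩
    have := hf.add hg
    rwa [add_zero] at this
  smul_mem' := by
    rintro c _ ⟨f, hf, rfl⟩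
    exact ⟨c • f, by simpa using hf.const_smul c, map_smul P c f⟩
  mul_mem' := by
    rintro _ _ ⟨f, hf, rfl⟩ ⟨g, hg, rfl⟩
    refine ⟨P f * g, ?_, hP.map_mul f g⟩
    refine squeeze_zero_norm (a := fun x => ‖P f‖ * ‖g x‖) (fun x => ?_) ?_
    · rw [BoundedContinuousFunction.coe_mul, Pi.mul_apply, norm_mul]
      exact mul_le_mul_of_nonneg_right ((P f).norm_coe_le_norm x) (norm_nonneg _)
    · simpa using hg.norm.const_mul ‖P f‖
  star_mem' := by
    rintro _ ⟨f, hf, rfl⟩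
    refine ⟨star f, ?_, hP.map_star f⟩
    have := hf.star
    rwa [star_zero] at this

/-- The spectrum `Q` of `B = P(C₀(G))`: the nonzero continuous multiplicative linear functionals
on `B`, with the weak-⋆ topology. -/
abbrev Spectrum (hP : IsConditionalExpectation P) : Type _ :=
  WeakDual.characterSpace ℂ (baseAlgebra hP)

instance (hP : IsConditionalExpectation P) : MeasurableSpace (Spectrum hP) := borel _

instance (hP : IsConditionalExpectation P) : BorelSpace (Spectrum hP) := ⟨rfl⟩

/-- Evaluation at `p ∈ G`, as a continuous linear functional on `B`. -/
def evalAt (hP : IsConditionalExpectation P) (p : G) : WeakDual ℂ (baseAlgebra hP) :=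
  StrongDual.toWeakDual
    (LinearMap.mkContinuous
      { toFun := fun b : baseAlgebra hP => (b : G →ᵇ ℂ) p
        map_add' := fun _ _ => rfl
        map_smul' := fun _ _ => rfl } 1
      (fun b => by simpa using (b : G →ᵇ ℂ).norm_coe_le_norm p))

theorem evalAt_apply (hP : IsConditionalExpectation P) (p : G) (b : baseAlgebra hP) :
    evalAt hP p b = (b : G →ᵇ ℂ) p := rfl

theorem tendsto_zero_of_hasCompactSupport {f : G →ᵇ ℂ} (hf : HasCompactSupport f) :
    Tendsto f (cocompact G) (𝓝 0) :=
  hf.is_zero_at_infty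

/-- The map `φ : G → Q` given by restricting point evaluations to `B`. -/
def proj (hP : IsConditionalExpectation P) (hK : PreservesCompactPositivity P) :
    C(G, Spectrum hP) where
  toFun p := ⟨evalAt hP p, by
    refine ⟨fun h => ?_, fun _ _ => rfl⟩
    obtain ⟨k, hk, -, hne⟩ := hK.exists_pos p
    have h1 : evalAt hP p ⟨P k, k, tendsto_zero_of_hasCompactSupport hk, rfl⟩ = 0 := by
      rw [h]; rfl
    exact hne h1⟩
  continuous_toFun := by
    refine Continuous.subtype_mk ?_ _
    exact WeakDual.continuous_of_continuous_eval fun b => (b : G →ᵇ ℂ).continuous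

theorem proj_apply (hP : IsConditionalExpectation P) (hK : PreservesCompactPositivity P)
    (p : G) (b : baseAlgebra hP) : proj hP hK p b = (b : G →ᵇ ℂ) p := rfl

variable [Group G] [IsTopologicalGroup G]

/-- The involution `b ↦ b̌` of `B`, `b̌(p) = b(p⁻¹)`. -/
def checkBase (hP : IsConditionalExpectation P) (hinv : ∀ f, P (check f) = check (P f)) :
    baseAlgebra hP →L[ℂ] baseAlgebra hP :=
  LinearMap.mkContinuous
    { toFun := fun b => ⟨check (b : G →ᵇ ℂ), by
        obtain ⟨f, hf, hb⟩ := b.2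
        refine ⟨check f, ?_, by rw [hinv, hb]⟩
        exact hf.comp (Homeomorph.inv G).isClosedEmbedding.tendsto_cocompact⟩
      map_add' := fun _ _ => rfl
      map_smul' := fun _ _ => rfl } 1
    (fun b => by
      rw [one_mul]
      exact (BoundedContinuousFunction.norm_le (norm_nonneg (b : G →ᵇ ℂ))).2
        fun x => (b : G →ᵇ ℂ).norm_coe_le_norm x⁻¹)

theorem checkBase_checkBase (hP : IsConditionalExpectation P)
    (hinv : ∀ f, P (check f) = check (P f)) (b : baseAlgebra hP) :
    checkBase hP hinv (checkBase hP hinv b) = b := by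
  apply Subtype.ext
  ext p
  exact congrArg (b : G →ᵇ ℂ) (inv_inv p)

/-- The map `s ↦ š` of `Q`, `š(b) = s(b̌)`. -/
def checkFun (hP : IsConditionalExpectation P) (hinv : ∀ f, P (check f) = check (P f))
    (s : Spectrum hP) : Spectrum hP :=
  ⟨StrongDual.toWeakDual ((WeakDual.CharacterSpace.toCLM s).comp (checkBase hP hinv)), by
    refine ⟨fun h => s.2.1 ?_, fun a b => s.2.2 (checkBase hP hinv a) (checkBase hP hinv b)⟩
    refine DFunLike.ext _ _ fun b => ?_
    have h1 := DFunLike.congr_fun h (checkBase hP hinv b)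
    have h2 : s (checkBase hP hinv (checkBase hP hinv b)) = 0 := h1
    rw [checkBase_checkBase] at h2
    exact h2⟩

theorem checkFun_apply (hP : IsConditionalExpectation P)
    (hinv : ∀ f, P (check f) = check (P f)) (s : Spectrum hP) (b : baseAlgebra hP) :
    checkFun hP hinv s b = s (checkBase hP hinv b) := rfl

theorem checkFun_checkFun (hP : IsConditionalExpectation P)
    (hinv : ∀ f, P (check f) = check (P f)) (s : Spectrum hP) :
    checkFun hP hinv (checkFun hP hinv s) = s := by
  refine WeakDual.CharacterSpace.ext fun b => ?_
  rw [checkFun_apply, checkFun_apply, checkBase_checkBase]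

theorem continuous_checkFun (hP : IsConditionalExpectation P)
    (hinv : ∀ f, P (check f) = check (P f)) : Continuous (checkFun hP hinv) := by
  refine Continuous.subtype_mk ?_ _
  refine WeakDual.continuous_of_continuous_eval fun b => ?_
  exact (WeakDual.eval_continuous (checkBase hP hinv b)).comp continuous_subtype_val

/-- The map `s ↦ š` as a homeomorphism of `Q`. -/
def checkHomeo (hP : IsConditionalExpectation P) (hinv : ∀ f, P (check f) = check (P f)) :
    Spectrum hP ≃ₜ Spectrum hP where
  toFun := checkFun hP hinv
  invFun := checkFun hP hinv
  left_inv := checkFun_checkFun hP hinv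
  right_inv := checkFun_checkFun hP hinv
  continuous_toFun := continuous_checkFun hP hinv
  continuous_invFun := continuous_checkFun hP hinv

end Main

end CondExpectation

end

open Hypergroup CondExpectation

/-! The map `φ : G → Q` (`proj`) is surjective and proper. If a character `s` were no point
evaluation, some `b ≥ 0` in `B` with `s b = 0` would be positive on the compact support of a `P k`
with `s (P k) ≠ 0`; dividing by `b` and applying `P` gives `P k = b * P g`, so `s (P k) = 0`, a
contradiction (`proj_surjective`). Properness holds because the open sets `{t | t (P k) ≠ 0}` cover
`Q` and pull back into compact supports. Hence fibres are compact, `φ` is closed, and `φ × φ` is a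
quotient map.

The functional `h ↦ P h q` is positive, unital and supported by exactly the fibre through `q`
(`map_apply_eq_zero_of_forall_fibre`, `map_apply_pos`): `P` averages over fibres. So `f ∘ φ` is
fixed by `P`, and the hypotheses collapse `(P × P) Δ (f ∘ φ)` to a single average in either
variable. It is therefore constant on products of fibres and descends to `Q × Q`. Nonnegative `f`
with `f x > 0` at some `x` in `φ(φ⁻¹ s · φ⁻¹ t)` have positive value at `(s, t)`, and functions
vanishing on that set have value zero. It is thus the support of `ε_s * ε_t`, and the support axioms
become statements about products of fibres. Coassociativity is associativity of `G` together with
`(P × P) Δ (P h) = (P × P) Δ h`.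

On the side of measures, the comultiplication sends `C₀(Q)` only into `C_b(Q × Q)`, so bounded
measures must first be extended to `C_b`. This works since each is concentrated on a compact set up
to small mass. Fubini's theorem (`integral_partialIntegral_comm`) then turns coassociativity into
associativity of the convolution. -/

noncomputable section

namespace Hypergroup

/-! ### Integrals of bounded continuous functions against bounded measures -/

section Integral

variable {Q : Type*} [TopologicalSpace Q]

theorem norm_apply_le_norm (f : C₀(Q, ℂ)) (x : Q) : ‖f x‖ ≤ ‖f‖ :=
  f.toBCF.norm_coe_le_norm x

theorem norm_le_of_forall_norm_le {f : C₀(Q, ℂ)} {C : ℝ} (hC : 0 ≤ C) (h : ∀ x, ‖f x‖ ≤ C) :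
    ‖f‖ ≤ C := by
  rw [← ZeroAtInftyContinuousMap.norm_toBCF_eq_norm]
  exact (BoundedContinuousFunction.norm_le hC).2 h

theorem isCompact_setOf_le_norm (f : C₀(Q, ℂ)) {ε : ℝ} (hε : 0 < ε) :
    ∃ K : Set Q, IsCompact K ∧ ∀ x ∉ K, ‖f x‖ < ε := by
  have h := f.zero_at_infty'.norm
  rw [norm_zero] at h
  obtain ⟨K, hK, hKs⟩ := mem_cocompact.1 (h.eventually (gt_mem_nhds hε))
  exact ⟨K, hK, fun x hx => hKs hx⟩

/-- A bounded measure is concentrated, up to small mass, on a compact set. -/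
theorem exists_isCompact_norm_apply_le (μ : BoundedMeasure Q) {ε : ℝ} (hε : 0 < ε) :
    ∃ K : Set Q, IsCompact K ∧ ∀ f : C₀(Q, ℂ), (∀ x ∈ K, f x = 0) → ‖μ f‖ ≤ ε * ‖f‖ := by
  obtain ⟨u, hu1, hu⟩ := μ.exists_lt_apply_of_lt_opNorm (r := ‖μ‖ - ε / 2) (by linarith)
  have hμ : 0 < ‖μ‖ + 1 := by positivity
  obtain ⟨K, hK, hKu⟩ := isCompact_setOf_le_norm u (ε := ε / 2 / (‖μ‖ + 1)) (by positivity)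
  refine ⟨K, hK, fun f hf => ?_⟩
  obtain ⟨c, hc, hcu⟩ := RCLike.exists_norm_eq_mul_self (μ u)
  obtain ⟨d, hd, hdf⟩ := RCLike.exists_norm_eq_mul_self (μ f)
  set δ := ε / 2 / (‖μ‖ + 1) with hδ
  have hδ0 : 0 < δ := by positivity
  -- The vector `u` almost attains `‖μ‖` and is small off `K`, whereas `f` lives off `K`. With
  -- phases `c`, `d` aligned, the combination has norm barely above `‖f‖`, so almost nothing of
  -- `‖μ‖` is left for `μ f`.
  have h1 : μ (((‖f‖ : ℂ) * c) • u + d • f) = ((‖f‖ * ‖μ u‖ + ‖μ f‖ : ℝ) : ℂ) := by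
    rw [map_add, map_smul, map_smul, smul_eq_mul, smul_eq_mul]
    push_cast
    rw [show ((‖μ u‖ : ℝ) : ℂ) = c * μ u from hcu, show ((‖μ f‖ : ℝ) : ℂ) = d * μ f from hdf]
    ring
  have h2 : ‖((‖f‖ : ℂ) * c) • u + d • f‖ ≤ ‖f‖ * (1 + δ) := by
    refine norm_le_of_forall_norm_le (by positivity) fun x => ?_
    rw [ZeroAtInftyContinuousMap.add_apply, ZeroAtInftyContinuousMap.smul_apply,
      ZeroAtInftyContinuousMap.smul_apply]
    refine (norm_add_le _ _).trans ?_
    rw [norm_smul, norm_smul, norm_mul, hc, hd, Complex.norm_real, norm_norm]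
    by_cases hx : x ∈ K
    · rw [hf x hx, norm_zero]
      have := (norm_apply_le_norm u x).trans hu1.le
      have h0 := norm_nonneg f
      nlinarith [norm_nonneg (u x)]
    · have h3 := (hKu x hx).le
      have h4 := norm_apply_le_norm f x
      have h0 := norm_nonneg f
      nlinarith
  have h3 := μ.le_opNorm (((‖f‖ : ℂ) * c) • u + d • f)
  rw [h1, Complex.norm_real, Real.norm_of_nonneg (by positivity)] at h3
  have h4 : ‖μ‖ * δ ≤ ε / 2 := by
    rw [hδ, mul_div_assoc', div_le_iff₀ hμ]
    nlinarith
  have h5 := mul_le_mul_of_nonneg_left h2 (norm_nonneg μ)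
  have h0 := norm_nonneg f
  nlinarith [mul_le_mul_of_nonneg_left h4 h0, mul_le_mul_of_nonneg_left hu.le h0]

/-- Functions in `C₀(Q)` with values in `[0, 1]` that are one on a given set. -/
def cutoffSet (K : Set Q) : Set C₀(Q, ℂ) :=
  {χ | (∀ x, 0 ≤ χ x ∧ χ x ≤ 1) ∧ ∀ x ∈ K, χ x = 1}

/-- The filter of cutoff functions which become one on larger and larger compact sets. -/
def cutoffFilter (Q : Type*) [TopologicalSpace Q] : Filter C₀(Q, ℂ) :=
  ⨅ K : TopologicalSpace.Compacts Q, 𝓟 (cutoffSet (K : Set Q))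

theorem cutoffSet_anti {K L : Set Q} (h : K ⊆ L) : cutoffSet L ⊆ cutoffSet K :=
  fun _ hχ => ⟨hχ.1, fun x hx => hχ.2 x (h hx)⟩

theorem hasBasis_cutoffFilter :
    (cutoffFilter Q).HasBasis (fun K : Set Q => IsCompact K) cutoffSet := by
  have h : (cutoffFilter Q).HasBasis (fun _ : TopologicalSpace.Compacts Q => True)
      (fun K => cutoffSet (K : Set Q)) := by
    refine hasBasis_iInf_principal fun K L => ⟨K ⊔ L, ?_, ?_⟩
    · exact cutoffSet_anti (by simp)
    · exact cutoffSet_anti (by simp)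
  refine h.to_hasBasis (fun K _ => ⟨K, K.isCompact, subset_rfl⟩) fun K hK =>
    ⟨⟨K, hK⟩, trivial, subset_rfl⟩

theorem norm_le_one_of_mem_cutoffSet {K : Set Q} {χ : C₀(Q, ℂ)} (hχ : χ ∈ cutoffSet K) (x : Q) :
    ‖χ x‖ ≤ 1 := by
  obtain ⟨h0, h1⟩ := hχ.1 x
  rw [← Complex.real_le_real, Complex.ofReal_one]
  simpa [Complex.norm_of_nonneg' h0] using h1

theorem norm_one_sub_le_one_of_mem_cutoffSet {K : Set Q} {χ : C₀(Q, ℂ)} (hχ : χ ∈ cutoffSet K)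
    (x : Q) : ‖1 - χ x‖ ≤ 1 := by
  obtain ⟨h0, h1⟩ := hχ.1 x
  have h2 : 0 ≤ 1 - χ x := sub_nonneg.2 h1
  rw [← Complex.real_le_real, Complex.ofReal_one, Complex.norm_of_nonneg' h2]
  simpa using h0

theorem cutoff_apply (χ : C₀(Q, ℂ)) (g : Q →ᵇ ℂ) (x : Q) : cutoff χ g x = χ x * g x := rfl

theorem norm_cutoff_le {K : Set Q} {χ : C₀(Q, ℂ)} (hχ : χ ∈ cutoffSet K) (g : Q →ᵇ ℂ) :
    ‖cutoff χ g‖ ≤ ‖g‖ := by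
  refine norm_le_of_forall_norm_le (norm_nonneg g) fun x => ?_
  rw [cutoff_apply, norm_mul]
  exact (mul_le_of_le_one_left (norm_nonneg _) (norm_le_one_of_mem_cutoffSet hχ x)).trans
    (g.norm_coe_le_norm x)

theorem cutoff_add (χ : C₀(Q, ℂ)) (g h : Q →ᵇ ℂ) :
    cutoff χ (g + h) = cutoff χ g + cutoff χ h := by
  ext x
  exact mul_add _ _ _

theorem cutoff_smul (χ : C₀(Q, ℂ)) (c : ℂ) (g : Q →ᵇ ℂ) :
    cutoff χ (c • g) = c • cutoff χ g := by
  ext x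
  exact mul_left_comm _ _ _

/-- As a limit along a filter, the integral inherits uniqueness and linearity from the general
theory of limits. -/
theorem hasIntegral_iff_tendsto {μ : BoundedMeasure Q} {g : Q →ᵇ ℂ} {c : ℂ} :
    HasIntegral μ g c ↔ Tendsto (fun χ => μ (cutoff χ g)) (cutoffFilter Q) (𝓝 c) := by
  rw [(hasBasis_cutoffFilter (Q := Q)).tendsto_iff Metric.nhds_basis_closedBall]
  refine forall₂_congr fun ε _ => exists_congr fun K => and_congr_right fun _ => ?_
  simp only [Metric.mem_closedBall, dist_eq_norm]
  exact ⟨fun h χ hχ => h χ hχ.1 hχ.2, fun h χ h1 h2 => h χ ⟨h1, h2⟩⟩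

variable [LocallyCompactSpace Q] [T2Space Q]

theorem exists_hasCompactSupport_mem_cutoffSet {K : Set Q} (hK : IsCompact K) :
    ∃ χ ∈ cutoffSet K, HasCompactSupport χ := by
  obtain ⟨f, h1, -, hc, h01⟩ :=
    exists_continuous_one_zero_of_isCompact hK isClosed_empty (Set.disjoint_empty K)
  have hc' : HasCompactSupport fun x => ((f x : ℝ) : ℂ) :=
    hc.comp_left (g := fun r : ℝ => (r : ℂ)) (by simp)
  refine ⟨⟨⟨fun x => ((f x : ℝ) : ℂ), by fun_prop⟩, hc'.is_zero_at_infty⟩, ⟨fun x => ?_, ?_⟩, hc'⟩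
  · have h := h01 x
    constructor
    · exact Complex.zero_le_real.2 h.1
    · change ((f x : ℝ) : ℂ) ≤ 1
      exact_mod_cast h.2
  · intro x hx
    change ((f x : ℝ) : ℂ) = 1
    rw [h1 hx]
    simp

instance : (cutoffFilter Q).NeBot :=
  hasBasis_cutoffFilter.neBot_iff.2 fun {_} hK =>
    let ⟨χ, hχ, _⟩ := exists_hasCompactSupport_mem_cutoffSet hK
    ⟨χ, hχ⟩

/-- The values form a Cauchy filter: two cutoffs of `g` that are one on `K` differ by a function
vanishing on `K`, and `μ` is nearly concentrated there. -/
theorem exists_hasIntegral (μ : BoundedMeasure Q) (g : Q →ᵇ ℂ) : ∃ c, HasIntegral μ g c := by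
  simp only [hasIntegral_iff_tendsto]
  refine cauchy_map_iff_exists_tendsto.1 (Metric.cauchy_iff.2 ⟨inferInstance, fun ε hε => ?_⟩)
  have hg : 0 < ‖g‖ + 1 := by positivity
  obtain ⟨K, hK, hKμ⟩ := exists_isCompact_norm_apply_le μ (ε := ε / 4 / (‖g‖ + 1)) (by positivity)
  refine ⟨_, image_mem_map (hasBasis_cutoffFilter.mem_of_mem hK), ?_⟩
  rintro _ ⟨χ, hχ, rfl⟩ _ ⟨ψ, hψ, rfl⟩
  rw [dist_eq_norm, ← map_sub]
  have h1 := hKμ (cutoff χ g - cutoff ψ g) fun x hx => by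
    rw [ZeroAtInftyContinuousMap.sub_apply, cutoff_apply, cutoff_apply, hχ.2 x hx, hψ.2 x hx,
      sub_self]
  have h2 : ‖cutoff χ g - cutoff ψ g‖ ≤ 2 * (‖g‖ + 1) :=
    (norm_sub_le _ _).trans (by linarith [norm_cutoff_le hχ g, norm_cutoff_le hψ g])
  calc _ ≤ ε / 4 / (‖g‖ + 1) * ‖cutoff χ g - cutoff ψ g‖ := h1
    _ ≤ ε / 4 / (‖g‖ + 1) * (2 * (‖g‖ + 1)) := by gcongr
    _ = ε / 2 := by field_simp; norm_num
    _ < ε := by linarith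

/-- The integral of a bounded continuous function against a bounded measure. -/
def integral (μ : BoundedMeasure Q) (g : Q →ᵇ ℂ) : ℂ := (exists_hasIntegral μ g).choose

theorem hasIntegral_integral (μ : BoundedMeasure Q) (g : Q →ᵇ ℂ) :
    HasIntegral μ g (integral μ g) := (exists_hasIntegral μ g).choose_spec

theorem tendsto_integral (μ : BoundedMeasure Q) (g : Q →ᵇ ℂ) :
    Tendsto (fun χ => μ (cutoff χ g)) (cutoffFilter Q) (𝓝 (integral μ g)) :=
  hasIntegral_iff_tendsto.1 (hasIntegral_integral μ g)

theorem HasIntegral.integral_eq {μ : BoundedMeasure Q} {g : Q →ᵇ ℂ} {c : ℂ}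
    (h : HasIntegral μ g c) : integral μ g = c :=
  tendsto_nhds_unique (tendsto_integral μ g) (hasIntegral_iff_tendsto.1 h)

theorem integral_add (μ : BoundedMeasure Q) (g h : Q →ᵇ ℂ) :
    integral μ (g + h) = integral μ g + integral μ h := by
  refine tendsto_nhds_unique (tendsto_integral μ _) ?_
  simp only [cutoff_add, map_add]
  exact (tendsto_integral μ g).add (tendsto_integral μ h)

theorem integral_smul (μ : BoundedMeasure Q) (c : ℂ) (g : Q →ᵇ ℂ) :
    integral μ (c • g) = c * integral μ g := by
  refine tendsto_nhds_unique (tendsto_integral μ _) ?_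
  simp only [cutoff_smul, map_smul, smul_eq_mul]
  exact (tendsto_integral μ g).const_mul c

theorem integral_sub (μ : BoundedMeasure Q) (g h : Q →ᵇ ℂ) :
    integral μ (g - h) = integral μ g - integral μ h := by
  have h1 := integral_add μ (g - h) h
  rw [sub_add_cancel] at h1
  rw [h1, add_sub_cancel_right]

theorem integral_sum {ι : Type*} (s : Finset ι) (μ : BoundedMeasure Q) (g : ι → Q →ᵇ ℂ) :
    integral μ (∑ i ∈ s, g i) = ∑ i ∈ s, integral μ (g i) :=
  map_sum (AddMonoidHom.mk' (integral μ) (integral_add μ)) g s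

theorem add_integral (μ ν : BoundedMeasure Q) (g : Q →ᵇ ℂ) :
    integral (μ + ν) g = integral μ g + integral ν g :=
  tendsto_nhds_unique (tendsto_integral _ g) ((tendsto_integral μ g).add (tendsto_integral ν g))

theorem smul_integral (c : ℂ) (μ : BoundedMeasure Q) (g : Q →ᵇ ℂ) :
    integral (c • μ) g = c * integral μ g :=
  tendsto_nhds_unique (tendsto_integral _ g) ((tendsto_integral μ g).const_mul c)

theorem norm_integral_le (μ : BoundedMeasure Q) (g : Q →ᵇ ℂ) :
    ‖integral μ g‖ ≤ ‖μ‖ * ‖g‖ := by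
  refine le_of_tendsto (tendsto_integral μ g).norm ?_
  filter_upwards [hasBasis_cutoffFilter.mem_of_mem isCompact_empty] with χ hχ
  exact (μ.le_opNorm _).trans (mul_le_mul_of_nonneg_left (norm_cutoff_le hχ g) (norm_nonneg μ))

theorem integral_toBCF (μ : BoundedMeasure Q) (f : C₀(Q, ℂ)) : integral μ f.toBCF = μ f := by
  refine tendsto_nhds_unique (tendsto_integral μ _) ((μ.continuous.tendsto f).comp ?_)
  rw [hasBasis_cutoffFilter.tendsto_iff Metric.nhds_basis_closedBall]
  intro ε hε
  obtain ⟨K, hK, hKf⟩ := isCompact_setOf_le_norm f hε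
  refine ⟨K, hK, fun χ hχ => ?_⟩
  rw [Metric.mem_closedBall, dist_comm, dist_eq_norm]
  refine norm_le_of_forall_norm_le hε.le fun x => ?_
  have h1 : (f - cutoff χ f.toBCF) x = (1 - χ x) * f x := by
    change f x - χ x * f x = _
    ring
  rw [h1, norm_mul]
  by_cases hx : x ∈ K
  · rw [hχ.2 x hx]
    simpa using hε.le
  · exact (mul_le_of_le_one_left (norm_nonneg _)
      (norm_one_sub_le_one_of_mem_cutoffSet hχ x)).trans (hKf x hx).le

theorem integral_dirac (s : Q) (g : Q →ᵇ ℂ) : integral (dirac s) g = g s := by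
  refine HasIntegral.integral_eq fun ε hε => ⟨{s}, isCompact_singleton, fun χ _ h => ?_⟩
  have h1 : dirac s (cutoff χ g) = χ s * g s := rfl
  rw [h1, h s rfl, one_mul, sub_self, norm_zero]
  exact hε.le

/-- Up to a small error, integrals are controlled by the values on a compact set. -/
theorem exists_isCompact_norm_integral_le (μ : BoundedMeasure Q) {ε : ℝ} (hε : 0 < ε) :
    ∃ K : Set Q, IsCompact K ∧ ∀ (g : Q →ᵇ ℂ) (a : ℝ), 0 < a → (∀ x ∈ K, ‖g x‖ ≤ a) →
      ‖integral μ g‖ ≤ ‖μ‖ * a + ε * ‖g‖ := by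
  obtain ⟨K, hK, hKμ⟩ := exists_isCompact_norm_apply_le μ hε
  refine ⟨K, hK, fun g a ha hg => ?_⟩
  -- Truncate `g` radially at height `a`: the truncation `g₁` equals `g` on `K` and has norm at most
  -- `a`, while `g - g₁` vanishes on `K`.
  have hm : ∀ x, 0 < max a ‖g x‖ := fun x => lt_max_of_lt_left ha
  have hr0 : ∀ x, 0 ≤ a / max a ‖g x‖ := fun x => div_nonneg ha.le (hm x).le
  have hr1 : ∀ x, a / max a ‖g x‖ ≤ 1 := fun x => (div_le_one (hm x)).2 (le_max_left _ _)
  have hb : ∀ x, ‖((a / max a ‖g x‖ : ℝ) : ℂ) * g x‖ ≤ a := fun x => by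
    rw [norm_mul, Complex.norm_real, Real.norm_of_nonneg (hr0 x), div_mul_eq_mul_div,
      div_le_iff₀ (hm x)]
    exact mul_le_mul_of_nonneg_left (le_max_right _ _) ha.le
  let g₁ : Q →ᵇ ℂ := BoundedContinuousFunction.ofNormedAddCommGroup
    (fun x => ((a / max a ‖g x‖ : ℝ) : ℂ) * g x) (by
      refine Continuous.mul (Complex.continuous_ofReal.comp ?_) g.continuous
      exact continuous_const.div (by fun_prop) fun x => (hm x).ne') a hb
  have hg₁ : ∀ x, g₁ x = ((a / max a ‖g x‖ : ℝ) : ℂ) * g x := fun _ => rfl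
  have h1 : ‖g₁‖ ≤ a := (BoundedContinuousFunction.norm_le ha.le).2 hb
  have h2 : ‖g - g₁‖ ≤ ‖g‖ := by
    refine (BoundedContinuousFunction.norm_le (norm_nonneg _)).2 fun x => ?_
    have e : (g - g₁) x = ((1 - a / max a ‖g x‖ : ℝ) : ℂ) * g x := by
      rw [BoundedContinuousFunction.sub_apply, hg₁]
      push_cast
      ring
    rw [e, norm_mul, Complex.norm_real, Real.norm_of_nonneg (by linarith [hr1 x])]
    exact (mul_le_of_le_one_left (norm_nonneg _) (by linarith [hr0 x])).trans
      (g.norm_coe_le_norm x)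
  have h3 : ∀ x ∈ K, (g - g₁) x = 0 := fun x hx => by
    rw [BoundedContinuousFunction.sub_apply, hg₁, max_eq_left (hg x hx), div_self ha.ne']
    simp
  have h4 : ‖integral μ (g - g₁)‖ ≤ ε * ‖g‖ := by
    refine le_of_tendsto (tendsto_integral μ _).norm ?_
    -- The empty compact set imposes only `0 ≤ χ ≤ 1`, which suffices here.
    filter_upwards [hasBasis_cutoffFilter.mem_of_mem isCompact_empty] with χ hχ
    refine (hKμ _ fun x hx => ?_).trans
      (mul_le_mul_of_nonneg_left ((norm_cutoff_le hχ _).trans h2) hε.le)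
    rw [cutoff_apply, h3 x hx, mul_zero]
  have h5 : integral μ g = integral μ g₁ + integral μ (g - g₁) := by
    rw [← integral_add, add_sub_cancel]
  rw [h5]
  refine (norm_add_le _ _).trans (add_le_add ?_ h4)
  exact (norm_integral_le μ g₁).trans (mul_le_mul_of_nonneg_left h1 (norm_nonneg μ))

end Integral

end Hypergroup


namespace Hypergroup

/-! ### Iterated integrals and Fubini's theorem -/

section PartialIntegral

variable {X Q : Type*} [TopologicalSpace X] [TopologicalSpace Q]

theorem sectionRight_apply (F : X × Q →ᵇ ℂ) (s : X) (t : Q) : sectionRight F s t = F (s, t) := rfl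

theorem norm_sectionRight_le (F : X × Q →ᵇ ℂ) (s : X) : ‖sectionRight F s‖ ≤ ‖F‖ :=
  (BoundedContinuousFunction.norm_le (norm_nonneg F)).2 fun t => F.norm_coe_le_norm (s, t)

/-- Currying is continuous into the compact-open topology, that is, the topology of uniform
convergence on compact sets. -/
theorem eventually_forall_norm_sub_lt (F : X × Q →ᵇ ℂ) {K : Set Q} (hK : IsCompact K) (s : X)
    {ε : ℝ} (hε : 0 < ε) : ∀ᶠ x in 𝓝 s, ∀ t ∈ K, ‖F (x, t) - F (s, t)‖ < ε := by
  have hu := ContinuousMap.tendsto_iff_forall_isCompact_tendstoUniformlyOn.1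
    (F.toContinuousMap.curry.continuous.tendsto s) _ hK
  rw [Metric.tendstoUniformlyOn_iff] at hu
  filter_upwards [hu ε hε] with x hx t ht
  rw [← dist_eq_norm, dist_comm]
  exact hx t ht

/-- Approximation of a function of two variables by finite sums of products on a product of compact
sets. -/
theorem exists_finset_approx [LocallyCompactSpace X] [T2Space X] (F : X × Q →ᵇ ℂ)
    {K : Set X} {L : Set Q} (hK : IsCompact K) (hL : IsCompact L) {ε : ℝ} (hε : 0 < ε) :
    ∃ (ι : Finset X) (a : X → X →ᵇ ℂ) (T : X × Q →ᵇ ℂ),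
      (∀ s t, T (s, t) = ∑ i ∈ ι, a i s * F (i, t)) ∧ ‖T‖ ≤ ‖F‖ ∧
        ∀ s ∈ K, ∀ t ∈ L, ‖T (s, t) - F (s, t)‖ ≤ ε := by
  choose U hU hUo hUm using fun s : X =>
    eventually_nhds_iff.1 (eventually_forall_norm_sub_lt F hL s hε)
  obtain ⟨ι, -, hι⟩ := hK.elim_nhds_subcover U fun s _ => (hUo s).mem_nhds (hUm s)
  -- On each `U i` the section `F (s, ·)` is `ε`-close to `F (i, ·)` over `L`. Averaging the
  -- sections `F (i, ·)` with a partition of unity gives `T`; since the weights sum to at most one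
  -- everywhere, also `‖T‖ ≤ ‖F‖`.
  obtain ⟨ρ, hρ, -⟩ := PartitionOfUnity.exists_isSubordinate_of_locallyFinite_t2space hK
    (fun i : ι => U i) (fun i => hUo i) (locallyFinite_of_finite _)
    (by simpa [Set.iUnion_subtype] using hι)
  classical
  have hle : ∀ s, ∑ i : ι, ρ i s ≤ 1 := fun s => by
    rw [← finsum_eq_sum_of_fintype]
    exact ρ.sum_le_one s
  have hone : ∀ s ∈ K, ∑ i : ι, ρ i s = 1 := fun s hs => by
    rw [← finsum_eq_sum_of_fintype]
    exact ρ.sum_eq_one hs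
  let b : ι → X →ᵇ ℂ := fun i => BoundedContinuousFunction.ofNormedAddCommGroup
    (fun s => ((ρ i s : ℝ) : ℂ)) (by fun_prop) 1 fun s => by
      rw [Complex.norm_real, Real.norm_of_nonneg (ρ.nonneg i s)]
      exact ρ.le_one i s
  let a : X → X →ᵇ ℂ := fun x => if h : x ∈ ι then b ⟨x, h⟩ else 0
  have ha : ∀ (i : ι) s, a i s = ((ρ i s : ℝ) : ℂ) := fun i s => by
    simp only [a, i.2, dite_true]
    rfl
  have hsum : ∀ s t, ∑ i ∈ ι, a i s * F (i, t) = ∑ i : ι, ((ρ i s : ℝ) : ℂ) * F (i, t) :=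
    fun s t => by
      rw [← Finset.sum_coe_sort ι (fun i => a i s * F (i, t))]
      exact Finset.sum_congr rfl fun i _ => by rw [ha]
  let T : X × Q →ᵇ ℂ := BoundedContinuousFunction.ofNormedAddCommGroup
    (fun z => ∑ i ∈ ι, a i z.1 * F (i, z.2)) (by fun_prop) ‖F‖ fun z => by
      rw [hsum]
      calc ‖∑ i : ι, ((ρ i z.1 : ℝ) : ℂ) * F (i, z.2)‖
          ≤ ∑ i : ι, ρ i z.1 * ‖F‖ := norm_sum_le_of_le _ fun i _ => by
            rw [norm_mul, Complex.norm_real, Real.norm_of_nonneg (ρ.nonneg i _)]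
            exact mul_le_mul_of_nonneg_left (F.norm_coe_le_norm _) (ρ.nonneg i _)
        _ ≤ ‖F‖ := by
            rw [← Finset.sum_mul]
            exact mul_le_of_le_one_left (norm_nonneg F) (hle z.1)
  have hT : ∀ s t, T (s, t) = ∑ i ∈ ι, a i s * F (i, t) := fun _ _ => rfl
  refine ⟨ι, a, T, hT, ?_, fun s hs t ht => ?_⟩
  · exact BoundedContinuousFunction.norm_ofNormedAddCommGroup_le _ (norm_nonneg F) _
  · have e : T (s, t) - F (s, t) = ∑ i : ι, ((ρ i s : ℝ) : ℂ) * (F (i, t) - F (s, t)) := by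
      rw [hT, hsum]
      simp only [mul_sub, Finset.sum_sub_distrib]
      rw [← Finset.sum_mul, ← Complex.ofReal_sum, hone s hs, Complex.ofReal_one, one_mul]
    rw [e]
    calc ‖∑ i : ι, ((ρ i s : ℝ) : ℂ) * (F (i, t) - F (s, t))‖
        ≤ ∑ i : ι, ρ i s * ε := norm_sum_le_of_le _ fun i _ => by
          rw [norm_mul, Complex.norm_real, Real.norm_of_nonneg (ρ.nonneg i _)]
          by_cases h0 : ρ i s = 0
          · rw [h0, zero_mul, zero_mul]
          · refine mul_le_mul_of_nonneg_left ?_ (ρ.nonneg i _)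
            have : s ∈ U i := hρ i (subset_tsupport _ h0)
            rw [norm_sub_rev]
            exact (hU i s this t ht).le
      _ = ε := by rw [← Finset.sum_mul, hone s hs, one_mul]

variable [LocallyCompactSpace Q] [T2Space Q]

/-- The function `s ↦ ∫ F(s, t) dν(t)`. -/
def partialIntegral (ν : BoundedMeasure Q) (F : X × Q →ᵇ ℂ) : X →ᵇ ℂ :=
  BoundedContinuousFunction.ofNormedAddCommGroup (fun s => integral ν (sectionRight F s)) (by
    rw [continuous_iff_continuousAt]
    intro s
    rw [ContinuousAt, Metric.tendsto_nhds]
    intro ε hε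
    -- Error budget: at most `ε / 4` from `K`, where nearby sections are uniformly close, and at
    -- most `ε / 2` from the mass of `ν` outside.
    obtain ⟨K, hK, hKν⟩ := exists_isCompact_norm_integral_le ν
      (ε := ε / 4 / (‖F‖ + 1)) (by positivity)
    filter_upwards [eventually_forall_norm_sub_lt F hK s (ε := ε / 4 / (‖ν‖ + 1))
      (by positivity)] with x hx
    rw [dist_eq_norm, ← integral_sub]
    have h1 := hKν (sectionRight F x - sectionRight F s) _ (by positivity) fun t ht => (hx t ht).le
    have h2 : ‖sectionRight F x - sectionRight F s‖ ≤ 2 * (‖F‖ + 1) :=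
      (norm_sub_le _ _).trans
        (by linarith [norm_sectionRight_le F x, norm_sectionRight_le F s])
    have h3 : ‖ν‖ * (ε / 4 / (‖ν‖ + 1)) ≤ ε / 4 := by
      rw [mul_div_assoc', div_le_iff₀ (by positivity)]
      nlinarith [norm_nonneg ν]
    have h4 : ε / 4 / (‖F‖ + 1) * ‖sectionRight F x - sectionRight F s‖ ≤ ε / 2 := by
      calc _ ≤ ε / 4 / (‖F‖ + 1) * (2 * (‖F‖ + 1)) := by gcongr
        _ = ε / 2 := by field_simp; norm_num
    linarith) (‖ν‖ * ‖F‖) fun s => (norm_integral_le ν _).trans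
      (mul_le_mul_of_nonneg_left (norm_sectionRight_le F s) (norm_nonneg ν))

theorem partialIntegral_apply (ν : BoundedMeasure Q) (F : X × Q →ᵇ ℂ) (s : X) :
    partialIntegral ν F s = integral ν (sectionRight F s) := rfl

theorem norm_partialIntegral_le (ν : BoundedMeasure Q) (F : X × Q →ᵇ ℂ) :
    ‖partialIntegral ν F‖ ≤ ‖ν‖ * ‖F‖ :=
  (BoundedContinuousFunction.norm_le (by positivity)).2 fun s => (norm_integral_le ν _).trans
      (mul_le_mul_of_nonneg_left (norm_sectionRight_le F s) (norm_nonneg ν))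

theorem partialIntegral_add (ν : BoundedMeasure Q) (F F' : X × Q →ᵇ ℂ) :
    partialIntegral ν (F + F') = partialIntegral ν F + partialIntegral ν F' := by
  ext s
  exact integral_add ν (sectionRight F s) (sectionRight F' s)

theorem partialIntegral_sub (ν : BoundedMeasure Q) (F F' : X × Q →ᵇ ℂ) :
    partialIntegral ν (F - F') = partialIntegral ν F - partialIntegral ν F' := by
  ext s
  exact integral_sub ν (sectionRight F s) (sectionRight F' s)

theorem partialIntegral_smul (ν : BoundedMeasure Q) (c : ℂ) (F : X × Q →ᵇ ℂ) :
    partialIntegral ν (c • F) = c • partialIntegral ν F := by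
  ext s
  exact integral_smul ν c (sectionRight F s)

theorem add_partialIntegral (ν ν' : BoundedMeasure Q) (F : X × Q →ᵇ ℂ) :
    partialIntegral (ν + ν') F = partialIntegral ν F + partialIntegral ν' F := by
  ext s
  exact add_integral ν ν' _

theorem smul_partialIntegral (c : ℂ) (ν : BoundedMeasure Q) (F : X × Q →ᵇ ℂ) :
    partialIntegral (c • ν) F = c • partialIntegral ν F := by
  ext s
  exact smul_integral c ν _

variable [LocallyCompactSpace X] [T2Space X]

/-- Up to a small error, iterated integrals are controlled by the values on a product of compact
sets. -/
theorem exists_isCompact_norm_integral_partialIntegral_le (μ : BoundedMeasure X)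
    (ν : BoundedMeasure Q) {ε : ℝ} (hε : 0 < ε) (C : ℝ) :
    ∃ (K : Set X) (L : Set Q) (δ : ℝ), IsCompact K ∧ IsCompact L ∧ 0 < δ ∧
      ∀ F : X × Q →ᵇ ℂ, ‖F‖ ≤ C → (∀ s ∈ K, ∀ t ∈ L, ‖F (s, t)‖ ≤ δ) →
        ‖integral μ (partialIntegral ν F)‖ ≤ ε := by
  -- The total error will be `δ * (‖μ‖ * (‖ν‖ + 1 + |C|) + ‖ν‖ * |C|)`, which is at most `4 * δ * M
  -- = ε`.
  set M := (‖μ‖ + 1) * (‖ν‖ + 1) * (|C| + 1) with hM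
  have hM0 : 0 < M := by positivity
  set δ := ε / 4 / M with hδ
  have hδ0 : 0 < δ := by positivity
  obtain ⟨K, hK, hKμ⟩ := exists_isCompact_norm_integral_le μ hδ0
  obtain ⟨L, hL, hLν⟩ := exists_isCompact_norm_integral_le ν hδ0
  refine ⟨K, L, δ, hK, hL, hδ0, fun F hF hs => ?_⟩
  have hF' : ‖F‖ ≤ |C| := hF.trans (le_abs_self C)
  have h1 : ∀ s ∈ K, ‖partialIntegral ν F s‖ ≤ δ * (‖ν‖ + 1 + |C|) := fun s hsK => by
    have h2 := hLν (sectionRight F s) δ hδ0 fun t ht => hs s hsK t ht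
    have h3 := mul_le_mul_of_nonneg_left ((norm_sectionRight_le F s).trans hF') hδ0.le
    rw [partialIntegral_apply]
    nlinarith
  have h2 := hKμ (partialIntegral ν F) _ (by positivity) h1
  have h3 : ‖partialIntegral ν F‖ ≤ ‖ν‖ * |C| :=
    (norm_partialIntegral_le ν F).trans (mul_le_mul_of_nonneg_left hF' (norm_nonneg ν))
  have h4 : δ * M = ε / 4 := by
    rw [hδ]
    field_simp
  have h5 : ‖μ‖ * (‖ν‖ + 1 + |C|) + ‖ν‖ * |C| ≤ 4 * M := by
    rw [hM]
    have a := norm_nonneg μ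
    have b := norm_nonneg ν
    have c := abs_nonneg C
    nlinarith [mul_nonneg a b, mul_nonneg a c, mul_nonneg b c, mul_nonneg (mul_nonneg a b) c]
  have h6 := mul_le_mul_of_nonneg_left h3 hδ0.le
  have h7 := mul_le_mul_of_nonneg_left h5 hδ0.le
  nlinarith

/-- The function of two variables with the variables exchanged. -/
def flip (F : X × Q →ᵇ ℂ) : Q × X →ᵇ ℂ := F.compContinuous ⟨Prod.swap, continuous_swap⟩

/-- Fubini's theorem for bounded measures. -/
theorem integral_partialIntegral_comm (μ : BoundedMeasure X) (ν : BoundedMeasure Q)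
    (F : X × Q →ᵇ ℂ) :
    integral μ (partialIntegral ν F) = integral ν (partialIntegral μ (flip F)) := by
  rw [← sub_eq_zero, ← norm_le_zero_iff]
  refine le_of_forall_pos_le_add fun ε hε => ?_
  obtain ⟨K₁, L₁, δ₁, hK₁, hL₁, hδ₁, h₁⟩ :=
    exists_isCompact_norm_integral_partialIntegral_le μ ν (half_pos hε) (2 * ‖F‖)
  obtain ⟨L₂, K₂, δ₂, hL₂, hK₂, hδ₂, h₂⟩ :=
    exists_isCompact_norm_integral_partialIntegral_le ν μ (half_pos hε) (2 * ‖F‖)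
  -- For the finite sum of products `T` the two iterated integrals agree by linearity. Closeness is
  -- required on compact sets serving both orders of integration; elsewhere `‖T - F‖ ≤ 2 * ‖F‖` is
  -- enough.
  obtain ⟨ι, a, T, hT, hTF, hTd⟩ :=
    exists_finset_approx F (hK₁.union hK₂) (hL₁.union hL₂) (lt_min hδ₁ hδ₂)
  have e₁ : ∀ s, sectionRight T s = ∑ i ∈ ι, a i s • sectionRight F i := fun s => by
    ext t
    simp [sectionRight_apply, hT]
  have e₂ : ∀ t, sectionRight (flip T) t = ∑ i ∈ ι, F (i, t) • a i := fun t => by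
    ext s
    have : sectionRight (flip T) t s = T (s, t) := rfl
    simp [this, hT, mul_comm]
  have e₃ : partialIntegral ν T = ∑ i ∈ ι, integral ν (sectionRight F i) • a i := by
    ext s
    simp [partialIntegral_apply, e₁, integral_sum, integral_smul, mul_comm]
  have e₄ : partialIntegral μ (flip T) = ∑ i ∈ ι, integral μ (a i) • sectionRight F i := by
    ext t
    simp [partialIntegral_apply, e₂, integral_sum, integral_smul, sectionRight_apply, mul_comm]
  have e₅ : integral μ (partialIntegral ν T) = integral ν (partialIntegral μ (flip T)) := by
    simp [e₃, e₄, integral_sum, integral_smul, mul_comm]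
  have hn : ‖T - F‖ ≤ 2 * ‖F‖ := (norm_sub_le _ _).trans (by linarith)
  have hn' : ‖flip (T - F)‖ ≤ 2 * ‖F‖ :=
    ((BoundedContinuousFunction.norm_le (norm_nonneg _)).2
      fun z => (T - F).norm_coe_le_norm z.swap).trans hn
  have h₃ := h₁ (T - F) hn fun s hs t ht => (hTd s (Or.inl hs) t (Or.inl ht)).trans (min_le_left _ _)
  have h₄ := h₂ (flip (T - F)) hn' fun t ht s hs =>
    (hTd s (Or.inr hs) t (Or.inr ht)).trans (min_le_right _ _)
  have e₆ : flip (T - F) = flip T - flip F := rfl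
  rw [partialIntegral_sub, integral_sub] at h₃
  rw [e₆, partialIntegral_sub, integral_sub] at h₄
  have e₇ : integral μ (partialIntegral ν F) - integral ν (partialIntegral μ (flip F))
      = (integral ν (partialIntegral μ (flip T)) - integral ν (partialIntegral μ (flip F)))
        - (integral μ (partialIntegral ν T) - integral μ (partialIntegral ν F)) := by
    rw [e₅]
    ring
  rw [e₇, zero_add]
  exact (norm_sub_le _ _).trans (by linarith)

end PartialIntegral

/-! ### Convolution of bounded measures defined by a comultiplication -/

section Convolution

variable {Q : Type*} [TopologicalSpace Q] [LocallyCompactSpace Q] [T2Space Q]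

/-- A contractive coassociative comultiplication on `C_b(Q)` whose values on a product of compact
sets only depend on the values of the argument on a compact set. -/
structure IsLocalComultiplication (D : (Q →ᵇ ℂ) →ₗ[ℂ] (Q × Q →ᵇ ℂ)) : Prop where
  norm_le : ∀ f, ‖D f‖ ≤ ‖f‖
  exists_isCompact : ∀ K L : Set Q, IsCompact K → IsCompact L → ∃ C : Set Q, IsCompact C ∧
    ∀ f : Q →ᵇ ℂ, (∀ x ∈ C, f x = 0) → ∀ s ∈ K, ∀ t ∈ L, D f (s, t) = 0
  coassoc : ∀ f s t u, D (sectionLeft (D f) u) (s, t) = D (sectionRight (D f) s) (t, u)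

namespace IsLocalComultiplication

variable {D : (Q →ᵇ ℂ) →ₗ[ℂ] (Q × Q →ᵇ ℂ)} (hD : IsLocalComultiplication D)

/-- The convolution of two bounded measures with respect to a comultiplication. -/
def convolve (μ ν : BoundedMeasure Q) : BoundedMeasure Q :=
  LinearMap.mkContinuous
    { toFun := fun f => integral μ (partialIntegral ν (D f.toBCF))
      map_add' := fun f g => by
        have : (f + g).toBCF = f.toBCF + g.toBCF := rfl
        rw [this, map_add, partialIntegral_add, integral_add]
      map_smul' := fun c f => by
        have : (c • f).toBCF = c • f.toBCF := rfl
        rw [this, map_smul, partialIntegral_smul, integral_smul]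
        rfl } (‖μ‖ * ‖ν‖)
    (fun f => by
      refine (norm_integral_le _ _).trans ?_
      rw [mul_assoc]
      refine mul_le_mul_of_nonneg_left ((norm_partialIntegral_le _ _).trans ?_) (norm_nonneg μ)
      exact mul_le_mul_of_nonneg_left (hD.norm_le f.toBCF) (norm_nonneg ν))

/-- The convolution as a bilinear map. -/
def mul : BoundedMeasure Q →ₗ[ℂ] BoundedMeasure Q →ₗ[ℂ] BoundedMeasure Q :=
  LinearMap.mk₂ ℂ hD.convolve
    (fun μ μ' ν => by
      ext f
      exact add_integral μ μ' _)
    (fun c μ ν => by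
      ext f
      exact smul_integral c μ _)
    (fun μ ν ν' => by
      ext f
      change integral μ _ = integral μ _ + integral μ _
      rw [add_partialIntegral, integral_add])
    (fun c μ ν => by
      ext f
      change integral μ _ = c * integral μ _
      rw [smul_partialIntegral, integral_smul])

theorem mul_apply (μ ν : BoundedMeasure Q) (f : C₀(Q, ℂ)) :
    hD.mul μ ν f = integral μ (partialIntegral ν (D f.toBCF)) := rfl

/-- The convolution is defined by its values on `C₀(Q)`. Locality extends the formula to `C_b(Q)`:
once `χ` is one on a suitable compact `C`, the functions `D (χ f)` and `D f` agree on the compact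
product `K × L` that carries `μ` and `ν` up to `ε`. -/
theorem hasIntegral_mul (μ ν : BoundedMeasure Q) (f : Q →ᵇ ℂ) :
    HasIntegral (hD.mul μ ν) f (integral μ (partialIntegral ν (D f))) := by
  intro ε hε
  obtain ⟨K, L, δ, hK, hL, hδ, h⟩ :=
    exists_isCompact_norm_integral_partialIntegral_le μ ν hε (2 * ‖f‖)
  obtain ⟨C, hC, hCD⟩ := hD.exists_isCompact K L hK hL
  refine ⟨C, hC, fun χ h01 hχ => ?_⟩
  rw [mul_apply, ← integral_sub, ← partialIntegral_sub, ← map_sub]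
  refine h _ ((hD.norm_le _).trans ((norm_sub_le _ _).trans ?_)) fun s hs t ht => ?_
  · have h1 : ‖(cutoff χ f).toBCF‖ ≤ ‖f‖ := by
      rw [ZeroAtInftyContinuousMap.norm_toBCF_eq_norm]
      exact norm_cutoff_le (K := C) ⟨h01, hχ⟩ f
    linarith
  · rw [hCD _ (fun x hx => ?_) s hs t ht, norm_zero]
    · exact hδ.le
    · change χ x * f x - f x = 0
      rw [hχ x hx, one_mul, sub_self]

theorem integral_mul (μ ν : BoundedMeasure Q) (f : Q →ᵇ ℂ) :
    integral (hD.mul μ ν) f = integral μ (partialIntegral ν (D f)) :=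
  (hD.hasIntegral_mul μ ν f).integral_eq

theorem integral_mul_dirac (s t : Q) (f : Q →ᵇ ℂ) :
    integral (hD.mul (dirac s) (dirac t)) f = D f (s, t) := by
  rw [integral_mul, integral_dirac, partialIntegral_apply, integral_dirac, sectionRight_apply]

theorem mul_dirac_apply (s t : Q) (f : C₀(Q, ℂ)) :
    hD.mul (dirac s) (dirac t) f = D f.toBCF (s, t) := by
  rw [← integral_toBCF, integral_mul_dirac]

theorem isComultiplication_mul : IsComultiplication hD.mul D := by
  refine ⟨fun f s t => ?_, fun f μ ν => ⟨partialIntegral ν (D f), _,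
    fun s => hasIntegral_integral ν _, hasIntegral_integral μ _, hD.hasIntegral_mul μ ν f⟩⟩
  rw [← hD.integral_mul_dirac]
  exact hasIntegral_integral _ f

include hD in
-- Evaluation of `D` at `(s, t)` is integration against `ε_s * ε_t`, so Fubini moves it inside the
-- integral over `ρ`, where coassociativity applies. This is associativity with the first two
-- measures replaced by point masses; `mul_assoc` integrates it.
theorem map_partialIntegral_apply (ρ : BoundedMeasure Q) (f : Q →ᵇ ℂ) (s t : Q) :
    D (partialIntegral ρ (D f)) (s, t) = partialIntegral ρ (D (sectionRight (D f) s)) t := by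
  rw [← hD.integral_mul_dirac, integral_partialIntegral_comm, partialIntegral_apply]
  congr 1
  ext u
  rw [sectionRight_apply, ← hD.coassoc, ← hD.integral_mul_dirac]
  rfl

theorem mul_assoc (μ ν ρ : BoundedMeasure Q) :
    hD.mul (hD.mul μ ν) ρ = hD.mul μ (hD.mul ν ρ) := by
  ext f
  rw [mul_apply, mul_apply, integral_mul]
  congr 1
  ext s
  rw [partialIntegral_apply, partialIntegral_apply, integral_mul]
  congr 1
  ext t
  exact hD.map_partialIntegral_apply ρ _ s t

end IsLocalComultiplication

end Convolution

end Hypergroup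


namespace CondExpectation

/-! ### Positivity and supports for conditional expectations -/

section General

variable {X : Type*} [TopologicalSpace X] {P : (X →ᵇ ℂ) →L[ℂ] (X →ᵇ ℂ)}

/-- The module property gives `P k = P (P k * 1) = P k * P 1`, and at each point some `P k` is
nonzero. -/
theorem PreservesCompactPositivity.map_one [LocallyCompactSpace X] [T2Space X]
    (hK : PreservesCompactPositivity P) (hP : IsConditionalExpectation P) : P 1 = 1 := by
  ext x
  obtain ⟨k, -, -, hne⟩ := hK.exists_pos x
  have h := congrArg (fun g : X →ᵇ ℂ => g x) (hP.map_mul k 1)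
  simp only [mul_one, hP.idem, BoundedContinuousFunction.mul_apply] at h
  exact mul_left_cancel₀ hne (by simpa using h.symm)

theorem IsConditionalExpectation.mono (hP : IsConditionalExpectation P) {f g : X →ᵇ ℂ}
    (h : ∀ x, f x ≤ g x) (x : X) : P f x ≤ P g x := by
  have h1 := hP.nonneg_of_nonneg (g - f) (fun x => sub_nonneg.2 (h x)) x
  rw [map_sub] at h1
  exact sub_nonneg.1 h1

/-- The Schwarz inequality reduces vanishing for complex `f` to the nonnegative function `star f *
f`. -/
theorem IsConditionalExpectation.apply_eq_zero (hP : IsConditionalExpectation P) {f : X →ᵇ ℂ}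
    {x : X} (h : P (star f * f) x = 0) : P f x = 0 := by
  have h1 := hP.schwarz f x
  rw [h, hP.map_star] at h1
  have h2 : star (P f x) * P f x ≤ 0 := h1
  have h3 := le_antisymm h2 (star_mul_self_nonneg _)
  simpa using h3

theorem PreservesCompactPositivity.hasCompactSupport_map (hK : PreservesCompactPositivity P)
    (hP : IsConditionalExpectation P) {f : X →ᵇ ℂ} (hf : HasCompactSupport f) :
    HasCompactSupport (P f) := by
  have h1 : HasCompactSupport (star f * f) := hf.mul_left (f := star f) (f' := f)
  refine (hK.hasCompactSupport _ (fun x => star_mul_self_nonneg (f x)) h1).mono fun x hx => ?_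
  exact fun h => hx (hP.apply_eq_zero h)

end General

/-! ### Characters of `P(C₀(G))` and surjectivity of the projection -/

section Projection

variable {G : Type*} [TopologicalSpace G] [LocallyCompactSpace G] [T2Space G]
  {P : (G →ᵇ ℂ) →L[ℂ] (G →ᵇ ℂ)}

/-- The image under `P` of a compactly supported function, as an element of `P(C₀(G))`. -/
def toBase (hP : IsConditionalExpectation P) (k : G →ᵇ ℂ) (hk : HasCompactSupport k) :
    baseAlgebra hP := ⟨P k, k, tendsto_zero_of_hasCompactSupport hk, rfl⟩

theorem map_coe (hP : IsConditionalExpectation P) (b : baseAlgebra hP) :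
    P (b : G →ᵇ ℂ) = b := by
  obtain ⟨f, -, hb⟩ := b.2
  rw [← hb, hP.idem]

theorem map_coe_mul (hP : IsConditionalExpectation P) (b : baseAlgebra hP) (f : G →ᵇ ℂ) :
    P ((b : G →ᵇ ℂ) * f) = b * P f := by
  conv_lhs => rw [← map_coe hP b]
  rw [hP.map_mul, map_coe]

variable (hP : IsConditionalExpectation P) (hK : PreservesCompactPositivity P)

/-- Functions in the range of `P` are constant on the fibres of the projection. -/
theorem map_apply_eq_of_proj_eq {p q : G} (h : proj hP hK p = proj hP hK q) (f : G →ᵇ ℂ) :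
    P f p = P f q := by
  obtain ⟨k, hk, hPk, hne⟩ := hK.exists_pos p
  have h1 : ∀ b : baseAlgebra hP, (b : G →ᵇ ℂ) p = (b : G →ᵇ ℂ) q := fun b =>
    DFunLike.congr_fun h b
  have h2 := h1 (toBase hP k hk)
  -- `P f` itself need not lie in `B`, but `P k * P f = P (P k * f)` does, and `P k` can be
  -- cancelled at `p`.
  have h3 := h1 (toBase hP (P k * f) (hPk.mul_right (f' := f)))
  change P k p = P k q at h2
  change P (P k * f) p = P (P k * f) q at h3
  rw [hP.map_mul, BoundedContinuousFunction.mul_apply, BoundedContinuousFunction.mul_apply, ← h2]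
    at h3
  exact mul_left_cancel₀ hne h3

theorem exists_apply_eq_zero_of_ne {s : Spectrum hP} {x : G} (h : s ≠ proj hP hK x) :
    ∃ b : baseAlgebra hP, s b = 0 ∧ (b : G →ᵇ ℂ) x ≠ 0 := by
  obtain ⟨k, hk, -, hne⟩ := hK.exists_pos x
  have h1 : ∃ b : baseAlgebra hP, s b ≠ (b : G →ᵇ ℂ) x := by
    by_contra! h2
    exact h (WeakDual.CharacterSpace.ext h2)
  obtain ⟨b, hb⟩ := h1
  -- This is `(b - s b) * P k`; the factor `P k`, nonzero at `x`, replaces the possibly missing unit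
  -- of `B`.
  refine ⟨b * toBase hP k hk - s b • toBase hP k hk, ?_, ?_⟩
  · rw [map_sub, _root_.map_mul, map_smul, smul_eq_mul, sub_self]
  · have e : ((b * toBase hP k hk - s b • toBase hP k hk : baseAlgebra hP) : G →ᵇ ℂ) x
        = ((b : G →ᵇ ℂ) x - s b) * P k x := by
      rw [sub_mul]
      rfl
    rw [e]
    exact mul_ne_zero (sub_ne_zero.2 hb.symm) hne

/-- Near each point of `L` an element `star b * b` with `s b = 0` works, and finite sums of these
cover `L`. -/
theorem exists_nonneg_pos_of_forall_ne {s : Spectrum hP} {L : Set G} (hL : IsCompact L)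
    (h : ∀ x ∈ L, s ≠ proj hP hK x) :
    ∃ b : baseAlgebra hP, s b = 0 ∧ (∀ x, 0 ≤ (b : G →ᵇ ℂ) x) ∧
      ∀ x ∈ L, 0 < (b : G →ᵇ ℂ) x := by
  refine hL.induction_on (p := fun L => ∃ b : baseAlgebra hP, s b = 0 ∧
    (∀ x, 0 ≤ (b : G →ᵇ ℂ) x) ∧ ∀ x ∈ L, 0 < (b : G →ᵇ ℂ) x) ?_ ?_ ?_ ?_
  · exact ⟨0, map_zero s, fun x => le_rfl, fun x hx => hx.elim⟩
  · rintro S T hST ⟨b, h1, h2, h3⟩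
    exact ⟨b, h1, h2, fun x hx => h3 x (hST hx)⟩
  · rintro S T ⟨b, h1, h2, h3⟩ ⟨c, h4, h5, h6⟩
    refine ⟨b + c, by rw [map_add, h1, h4, add_zero], fun x => add_nonneg (h2 x) (h5 x), ?_⟩
    rintro x (hx | hx)
    · exact add_pos_of_pos_of_nonneg (h3 x hx) (h5 x)
    · exact add_pos_of_nonneg_of_pos (h2 x) (h6 x hx)
  · intro x hx
    obtain ⟨b, hb, hbx⟩ := exists_apply_eq_zero_of_ne hP hK (h x hx)
    refine ⟨{y | (b : G →ᵇ ℂ) y ≠ 0}, mem_nhdsWithin_of_mem_nhds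
      ((b : G →ᵇ ℂ).continuous.continuousAt.eventually_ne hbx), star b * b, ?_, fun y => ?_,
      fun y hy => ?_⟩
    · rw [_root_.map_mul, hb, mul_zero]
    · exact star_mul_self_nonneg ((b : G →ᵇ ℂ) y)
    · refine lt_of_le_of_ne (star_mul_self_nonneg ((b : G →ᵇ ℂ) y)) (Ne.symm ?_)
      exact mul_ne_zero (star_ne_zero.2 hy) hy

/-- A character of `P(C₀(G))` does not vanish on the image of the compactly supported functions. -/
theorem exists_apply_toBase_ne_zero (s : Spectrum hP) :
    ∃ (k : G →ᵇ ℂ) (hk : HasCompactSupport k), s (toBase hP k hk) ≠ 0 := by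
  by_contra! h
  refine s.2.1 (DFunLike.ext _ _ fun b => ?_)
  change WeakDual.CharacterSpace.toCLM s b = 0
  set S := WeakDual.CharacterSpace.toCLM s
  obtain ⟨f, hf, hb⟩ := b.2
  rw [← norm_le_zero_iff]
  refine le_of_forall_pos_le_add fun ε hε => ?_
  have hδ : 0 < ε / (‖S‖ + 1) := by positivity
  have hf' := hf.norm
  rw [norm_zero] at hf'
  obtain ⟨K, hKc, hKs⟩ := mem_cocompact.1 (hf'.eventually (gt_mem_nhds hδ))
  -- Cutting `f` off changes it little in norm and `P` is contractive, so images of compactly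
  -- supported functions are dense in `B`.
  obtain ⟨χ, hχ, hχc⟩ := exists_hasCompactSupport_mem_cutoffSet hKc
  have hk : HasCompactSupport (χ.toBCF * f) := hχc.mul_right (f := χ) (f' := f)
  have h1 : ‖f - χ.toBCF * f‖ ≤ ε / (‖S‖ + 1) := by
    refine (BoundedContinuousFunction.norm_le hδ.le).2 fun x => ?_
    have e : (f - χ.toBCF * f) x = (1 - χ x) * f x := by
      rw [sub_mul, one_mul]
      rfl
    rw [e, norm_mul]
    by_cases hx : x ∈ K
    · rw [hχ.2 x hx]
      simpa using hδ.le
    · have h2 : ‖f x‖ < ε / (‖S‖ + 1) := hKs hx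
      exact (mul_le_of_le_one_left (norm_nonneg _)
        (norm_one_sub_le_one_of_mem_cutoffSet hχ x)).trans h2.le
  have h2 : ‖b - toBase hP _ hk‖ ≤ ε / (‖S‖ + 1) := by
    have e : ((b - toBase hP _ hk : baseAlgebra hP) : G →ᵇ ℂ) = P (f - χ.toBCF * f) := by
      rw [map_sub, hb]
      rfl
    change ‖((b - toBase hP _ hk : baseAlgebra hP) : G →ᵇ ℂ)‖ ≤ _
    rw [e]
    refine (P.le_opNorm _).trans ?_
    rw [hP.norm_eq_one, one_mul]
    exact h1
  have h3 : S b = S (b - toBase hP _ hk) := by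
    rw [map_sub, show S (toBase hP _ hk) = 0 from h _ hk, sub_zero]
  rw [h3, zero_add]
  refine (S.le_opNorm _).trans ((mul_le_mul_of_nonneg_left h2 (norm_nonneg _)).trans ?_)
  rw [mul_div_assoc', div_le_iff₀ (by positivity)]
  nlinarith [norm_nonneg S]

/-- If `s` is no point evaluation, choose `b ∈ B` with `s b = 0` and `b > 0` on the support of `P
k`, where `s (P k) ≠ 0`. Then `g = P k / b` is continuous with compact support, and `P k = P (b * g)
= b * P g` forces `s (P k) = 0`. -/
theorem proj_surjective : Function.Surjective (proj hP hK) := by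
  intro s
  by_contra! h
  obtain ⟨k, hk, hs⟩ := exists_apply_toBase_ne_zero hP s
  have hc := hK.hasCompactSupport_map hP hk
  obtain ⟨b, hb, hb0, hbp⟩ := exists_nonneg_pos_of_forall_ne hP hK (s := s) hc
    fun x _ => (h x).symm
  have hcont : Continuous fun x => P k x / (b : G →ᵇ ℂ) x := by
    rw [continuous_iff_continuousAt]
    intro x
    by_cases hx : x ∈ tsupport (P k)
    · exact (P k).continuous.continuousAt.div (b : G →ᵇ ℂ).continuous.continuousAt (hbp x hx).ne'
    · have h1 : (fun x => P k x / (b : G →ᵇ ℂ) x) =ᶠ[𝓝 x] fun _ => 0 := by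
        filter_upwards [notMem_tsupport_iff_eventuallyEq.1 hx] with y hy
        rw [hy]
        exact zero_div _
      exact continuousAt_const.congr h1.symm
  have hgc : HasCompactSupport fun x => P k x / (b : G →ᵇ ℂ) x := by
    refine hc.mono fun x hx h0 => hx ?_
    change P k x / _ = 0
    rw [h0, zero_div]
  obtain ⟨C, hC⟩ := hgc.exists_bound_of_continuous hcont
  let g : G →ᵇ ℂ := BoundedContinuousFunction.ofNormedAddCommGroup _ hcont C hC
  have hg : P k = b * g := by
    ext x
    change P k x = (b : G →ᵇ ℂ) x * (P k x / (b : G →ᵇ ℂ) x)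
    by_cases hx : P k x = 0
    · rw [hx, zero_div, mul_zero]
    · rw [mul_div_cancel₀ _ (hbp x (subset_tsupport _ hx)).ne']
  have h1 : toBase hP k hk = b * toBase hP g hgc := by
    apply Subtype.ext
    change P k = b * P g
    rw [← map_coe_mul, ← hg, hP.idem]
  apply hs
  rw [h1, _root_.map_mul, hb, zero_mul]


end Projection

end CondExpectation

namespace CondExpectation

/-! ### Properness of the projection; `P` as an average over fibres -/

section Fibres

variable {G : Type*} [TopologicalSpace G] [LocallyCompactSpace G] [T2Space G]
  {P : (G →ᵇ ℂ) →L[ℂ] (G →ᵇ ℂ)}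
  (hP : IsConditionalExpectation P) (hK : PreservesCompactPositivity P)

include hK in
-- The set where the Gelfand transform of `P k` is nonzero pulls back into the support of `P k`.
-- This local form of properness also gives local compactness of `Q`.
theorem exists_isCompact_mem_nhds (s : Spectrum hP) :
    ∃ (V : Set (Spectrum hP)) (L : Set G), IsCompact L ∧ V ∈ 𝓝 s ∧ proj hP hK ⁻¹' V ⊆ L := by
  obtain ⟨k, hk, hs⟩ := exists_apply_toBase_ne_zero hP s
  refine ⟨{t | t (toBase hP k hk) ≠ 0}, tsupport (P k), hK.hasCompactSupport_map hP hk, ?_,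
    fun x hx => subset_tsupport _ hx⟩
  have hc : Continuous fun t : Spectrum hP => t (toBase hP k hk) :=
    (WeakDual.eval_continuous (toBase hP k hk)).comp continuous_subtype_val
  exact hc.continuousAt.eventually_ne hs

include hK in
theorem locallyCompactSpace_spectrum : LocallyCompactSpace (Spectrum hP) := by
  have : WeaklyLocallyCompactSpace (Spectrum hP) := by
    refine ⟨fun s => ?_⟩
    obtain ⟨V, L, hL, hV, hVL⟩ := exists_isCompact_mem_nhds hP hK s
    refine ⟨proj hP hK '' L, hL.image (proj hP hK).continuous, mem_of_superset hV fun t ht => ?_⟩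
    obtain ⟨x, rfl⟩ := proj_surjective hP hK t
    exact ⟨x, hVL ht, rfl⟩
  infer_instance

theorem isCompact_preimage_proj {K : Set (Spectrum hP)} (h : IsCompact K) :
    IsCompact (proj hP hK ⁻¹' K) := by
  have h1 : ∃ L : Set G, IsCompact L ∧ proj hP hK ⁻¹' K ⊆ L := by
    refine h.induction_on (p := fun K => ∃ L : Set G, IsCompact L ∧ proj hP hK ⁻¹' K ⊆ L)
      ⟨∅, isCompact_empty, by simp⟩ ?_ ?_ ?_
    · rintro S T hST ⟨L, hL, hTL⟩
      exact ⟨L, hL, (Set.preimage_mono hST).trans hTL⟩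
    · rintro S T ⟨L, hL, hSL⟩ ⟨M, hM, hTM⟩
      exact ⟨L ∪ M, hL.union hM, by
        rw [Set.preimage_union]
        exact Set.union_subset_union hSL hTM⟩
    · intro s _
      obtain ⟨V, L, hL, hV, hVL⟩ := exists_isCompact_mem_nhds hP hK s
      exact ⟨V, mem_nhdsWithin_of_mem_nhds hV, L, hL, hVL⟩
  obtain ⟨L, hL, hKL⟩ := h1
  exact hL.of_isClosed_subset (h.isClosed.preimage (proj hP hK).continuous) hKL

theorem isProperMap_proj : IsProperMap (proj hP hK) := by
  have := locallyCompactSpace_spectrum hP hK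
  exact isProperMap_iff_isCompact_preimage.2
    ⟨(proj hP hK).continuous, fun _ h => isCompact_preimage_proj hP hK h⟩

/-- Products of quotient maps need not be quotient maps, but products of proper maps are proper,
hence closed. -/
theorem isQuotientMap_prodMap_proj :
    IsQuotientMap (Prod.map (proj hP hK) (proj hP hK)) :=
  ((isProperMap_proj hP hK).prodMap (isProperMap_proj hP hK)).isClosedMap.isQuotientMap
    ((proj hP hK).continuous.prodMap (proj hP hK).continuous)
    ((proj_surjective hP hK).prodMap (proj_surjective hP hK))

theorem exists_mem_nhds_preimage_proj_subset {s : Spectrum hP} {U : Set G} (hU : IsOpen U)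
    (h : proj hP hK ⁻¹' {s} ⊆ U) : ∃ V ∈ 𝓝 s, proj hP hK ⁻¹' V ⊆ U := by
  refine ⟨(proj hP hK '' Uᶜ)ᶜ,
    ((isProperMap_proj hP hK).isClosedMap _ hU.isClosed_compl).isOpen_compl.mem_nhds ?_, ?_⟩
  · rintro ⟨x, hx, rfl⟩
    exact hx (h rfl)
  · intro x hx
    by_contra hxU
    exact hx ⟨x, hxU, rfl⟩

include hK in
/-- The functional `h ↦ P h q` is supported on the fibre through `q`. -/
theorem map_apply_eq_zero_of_forall_fibre {h : G →ᵇ ℂ} {q : G}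
    (hq : ∀ x, proj hP hK x = proj hP hK q → h x = 0) : P h q = 0 := by
  obtain ⟨k, hk, hPk, hne⟩ := hK.exists_pos q
  -- Multiplying by `P k` and then applying Schwarz reduces to a nonnegative compactly supported `v`
  -- vanishing on the fibre.
  suffices hw : P (P k * h) q = 0 by
    rw [hP.map_mul] at hw
    exact (mul_eq_zero.1 hw).resolve_left hne
  set w := P k * h with hw
  refine hP.apply_eq_zero ?_
  set v := star w * w with hv
  have hv0 : ∀ x, 0 ≤ v x := fun x => star_mul_self_nonneg (w x)
  rw [← norm_le_zero_iff]
  refine le_of_forall_pos_le_add fun ε hε => ?_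
  rw [zero_add]
  have hL : IsCompact (tsupport (P k) ∩ {x | ε ≤ ‖v x‖}) :=
    IsCompact.inter_right hPk (isClosed_le continuous_const v.continuous.norm)
  obtain ⟨b, hb, hb0, hbp⟩ := exists_nonneg_pos_of_forall_ne hP hK (s := proj hP hK q) hL (by
    rintro x ⟨-, hx⟩ hxq
    have h1 : v x = 0 := by
      change star (P k x * h x) * (P k x * h x) = 0
      rw [hq x hxq.symm, mul_zero, mul_zero]
    rw [Set.mem_ofPred_eq, h1, norm_zero] at hx
    exact absurd hx (not_le.2 hε))
  obtain ⟨δ, hδ, hδb⟩ := hL.exists_forall_le' (f := fun x => ‖(b : G →ᵇ ℂ) x‖) (a := 0)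
    (b : G →ᵇ ℂ).continuous.norm.continuousOn fun x hx => norm_pos_iff.2 (hbp x hx).ne'
  set C := ‖v‖ / δ with hC
  have hC0 : 0 ≤ C := by positivity
  -- The element `b` vanishes at `q` and is positive on the compact set where `v ≥ ε`, so `v ≤ ε + C
  -- b`. As `P` fixes both `1` and `b`, this gives `P v q ≤ ε`.
  have hle : ∀ x, v x ≤ ((ε : ℂ) • (1 : G →ᵇ ℂ) + (C : ℂ) • (b : G →ᵇ ℂ)) x := fun x => by
    rw [← Complex.norm_of_nonneg' (hv0 x)]
    change ((‖v x‖ : ℝ) : ℂ) ≤ (ε : ℂ) * 1 + (C : ℂ) * (b : G →ᵇ ℂ) x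
    rw [← Complex.norm_of_nonneg' (hb0 x), mul_one]
    norm_cast
    by_cases hx : ε ≤ ‖v x‖
    · have hxk : x ∈ tsupport (P k) := by
        by_contra hxk
        have h1 : v x = 0 := by
          change star (P k x * h x) * (P k x * h x) = 0
          rw [image_eq_zero_of_notMem_tsupport hxk, zero_mul, mul_zero]
        rw [h1, norm_zero] at hx
        exact absurd hx (not_le.2 hε)
      have h2 : ‖v‖ ≤ C * ‖(b : G →ᵇ ℂ) x‖ := by
        rw [hC, div_mul_eq_mul_div, le_div_iff₀ hδ]
        exact mul_le_mul_of_nonneg_left (hδb x ⟨hxk, hx⟩) (norm_nonneg v)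
      linarith [v.norm_coe_le_norm x]
    · have := mul_nonneg hC0 (norm_nonneg ((b : G →ᵇ ℂ) x))
      linarith
  have h1 := hP.mono hle q
  rw [map_add, map_smul, map_smul, hK.map_one hP, map_coe] at h1
  have h2 : P v q ≤ (ε : ℂ) * 1 + (C : ℂ) * (b : G →ᵇ ℂ) q := h1
  have h3 : (b : G →ᵇ ℂ) q = 0 := hb
  rw [h3, mul_zero, add_zero, mul_one, ← Complex.norm_of_nonneg' (hP.nonneg_of_nonneg v hv0 q)]
    at h2
  exact_mod_cast h2

theorem map_apply_eq_of_forall_fibre {h : G →ᵇ ℂ} {q : G}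
    (hq : ∀ x, proj hP hK x = proj hP hK q → h x = h q) : P h q = h q := by
  have h1 := map_apply_eq_zero_of_forall_fibre hP hK (h := h - h q • (1 : G →ᵇ ℂ)) (q := q)
    fun x hx => by
      change h x - h q * 1 = 0
      rw [hq x hx, mul_one, sub_self]
  rw [map_sub, map_smul, hK.map_one hP] at h1
  have h2 : P h q - h q * 1 = 0 := h1
  rw [mul_one] at h2
  exact sub_eq_zero.1 h2

/-- The pullback of a function on `Q` to `G`. -/
abbrev lift (f : Spectrum hP →ᵇ ℂ) : G →ᵇ ℂ := f.compContinuous (proj hP hK)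

/-- This makes the hypotheses on `Δ (P f)` applicable to functions lifted from `Q`. -/
theorem map_lift (f : Spectrum hP →ᵇ ℂ) : P (lift hP hK f) = lift hP hK f := by
  ext q
  exact map_apply_eq_of_forall_fibre hP hK fun x hx => congrArg f hx

/-- Strict positivity is assumed only for compactly supported functions and at the same point: cut
`h` off keeping its value at `x`, then move from `x` to `q` along the fibre. -/
theorem map_apply_pos {h : G →ᵇ ℂ} (h0 : ∀ x, 0 ≤ h x) {x q : G}
    (hx : proj hP hK x = proj hP hK q) (hpos : 0 < h x) : 0 < P h q := by
  obtain ⟨χ, hχ, hχc⟩ := exists_hasCompactSupport_mem_cutoffSet (isCompact_singleton (x := x))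
  have h1 : ∀ y, 0 ≤ (χ.toBCF * h) y := fun y => mul_nonneg (hχ.1 y).1 (h0 y)
  have h2 : ∀ y, (χ.toBCF * h) y ≤ h y := fun y => by
    have := mul_le_mul_of_nonneg_right (hχ.1 y).2 (h0 y)
    rw [one_mul] at this
    exact this
  have h3 : (χ.toBCF * h) x = h x := by
    change χ x * h x = h x
    rw [hχ.2 x rfl, one_mul]
  have h4 := hK.pos _ h1 (hχc.mul_right (f := χ) (f' := h)) x (by rw [h3]; exact hpos)
  rw [map_apply_eq_of_proj_eq hP hK hx] at h4
  exact h4.trans_le (hP.mono h2 q)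

end Fibres

/-! ### The comultiplication of `C_b(Q)` -/

section Comultiplication

open scoped Pointwise

variable {G : Type*} [TopologicalSpace G] [LocallyCompactSpace G] [T2Space G]
  [Group G] [IsTopologicalGroup G] {P : (G →ᵇ ℂ) →L[ℂ] (G →ᵇ ℂ)}
  (hP : IsConditionalExpectation P) (hK : PreservesCompactPositivity P)
  (hleft : ∀ f, tensorId hP hK (comul (P f)) = idTensor hP hK (comul (P f)))
  (hright : ∀ f, idTensor hP hK (comul (P f)) = tensor hP hK (comul f))

include hright in
theorem tensor_comul_lift_eq_right (f : Spectrum hP →ᵇ ℂ) (p q : G) :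
    tensor hP hK (comul (lift hP hK f)) (p, q)
      = P (sectionRight (comul (lift hP hK f)) p) q := by
  rw [← hright, map_lift, idTensor_apply]

include hleft hright in
theorem tensor_comul_lift_eq_left (f : Spectrum hP →ᵇ ℂ) (p q : G) :
    tensor hP hK (comul (lift hP hK f)) (p, q)
      = P (sectionLeft (comul (lift hP hK f)) q) p := by
  rw [← hright, ← hleft, map_lift, tensorId_apply]

include hleft hright in
-- Written as `P` in the second variable, the function depends on `q` only through its fibre;
-- written as `P` in the first, likewise for `p`.
theorem tensor_comul_lift_congr (f : Spectrum hP →ᵇ ℂ) {p p' q q' : G}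
    (hp : proj hP hK p = proj hP hK p') (hq : proj hP hK q = proj hP hK q') :
    tensor hP hK (comul (lift hP hK f)) (p, q) = tensor hP hK (comul (lift hP hK f)) (p', q') := by
  rw [tensor_comul_lift_eq_right hP hK hright, map_apply_eq_of_proj_eq hP hK hq,
    ← tensor_comul_lift_eq_right hP hK hright, tensor_comul_lift_eq_left hP hK hleft hright,
    map_apply_eq_of_proj_eq hP hK hp, ← tensor_comul_lift_eq_left hP hK hleft hright]

include hright in
theorem norm_tensor_comul_lift_le (f : Spectrum hP →ᵇ ℂ) (z : G × G) :
    ‖tensor hP hK (comul (lift hP hK f)) z‖ ≤ ‖f‖ := by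
  rw [← Prod.mk.eta (p := z), tensor_comul_lift_eq_right hP hK hright]
  refine ((P _).norm_coe_le_norm z.2).trans ((P.le_opNorm _).trans ?_)
  rw [hP.norm_eq_one, one_mul]
  exact (BoundedContinuousFunction.norm_le (norm_nonneg f)).2
    fun y => f.norm_coe_le_norm (proj hP hK (z.1 * y))

/-- A preimage of a point of `Q` in `G`. -/
def projInv : Spectrum hP → G := Function.surjInv (proj_surjective hP hK)

theorem proj_projInv (s : Spectrum hP) : proj hP hK (projInv hP hK s) = s :=
  Function.surjInv_eq _ s

/-- The comultiplication of `C_b(Q)`. -/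
def comulSpectrum : (Spectrum hP →ᵇ ℂ) →ₗ[ℂ] (Spectrum hP × Spectrum hP →ᵇ ℂ) where
  toFun f := BoundedContinuousFunction.ofNormedAddCommGroup
    (fun z => tensor hP hK (comul (lift hP hK f)) (projInv hP hK z.1, projInv hP hK z.2)) (by
      rw [(isQuotientMap_prodMap_proj hP hK).continuous_iff]
      refine (tensor hP hK (comul (lift hP hK f))).continuous.congr fun z => ?_
      exact tensor_comul_lift_congr hP hK hleft hright f (proj_projInv hP hK _).symm
        (proj_projInv hP hK _).symm) ‖f‖ fun z => norm_tensor_comul_lift_le hP hK hright f _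
  map_add' f g := by
    ext z
    change tensor hP hK (comul (lift hP hK (f + g))) (projInv hP hK z.1, projInv hP hK z.2)
      = tensor hP hK (comul (lift hP hK f)) (projInv hP hK z.1, projInv hP hK z.2)
        + tensor hP hK (comul (lift hP hK g)) (projInv hP hK z.1, projInv hP hK z.2)
    simp only [tensor_comul_lift_eq_right hP hK hright]
    rw [← BoundedContinuousFunction.add_apply, ← map_add]
    rfl
  map_smul' c f := by
    ext z
    change tensor hP hK (comul (lift hP hK (c • f))) (projInv hP hK z.1, projInv hP hK z.2)
      = c • tensor hP hK (comul (lift hP hK f)) (projInv hP hK z.1, projInv hP hK z.2)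
    simp only [tensor_comul_lift_eq_right hP hK hright]
    rw [← BoundedContinuousFunction.smul_apply, ← map_smul]
    rfl

theorem comulSpectrum_apply (f : Spectrum hP →ᵇ ℂ) (p q : G) :
    comulSpectrum hP hK hleft hright f (proj hP hK p, proj hP hK q)
      = tensor hP hK (comul (lift hP hK f)) (p, q) :=
  tensor_comul_lift_congr hP hK hleft hright f (proj_projInv hP hK _) (proj_projInv hP hK _)

theorem comulSpectrum_apply_right (f : Spectrum hP →ᵇ ℂ) (p q : G) :
    comulSpectrum hP hK hleft hright f (proj hP hK p, proj hP hK q)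
      = P (sectionRight (comul (lift hP hK f)) p) q := by
  rw [comulSpectrum_apply, tensor_comul_lift_eq_right hP hK hright]

theorem comulSpectrum_apply_left (f : Spectrum hP →ᵇ ℂ) (p q : G) :
    comulSpectrum hP hK hleft hright f (proj hP hK p, proj hP hK q)
      = P (sectionLeft (comul (lift hP hK f)) q) p := by
  rw [comulSpectrum_apply, tensor_comul_lift_eq_left hP hK hleft hright]

/-- The convolution product of two points of `Q`, as a set: the image of the product of the
fibres. -/
def mulSet (s t : Spectrum hP) : Set (Spectrum hP) :=
  proj hP hK '' (proj hP hK ⁻¹' {s} * proj hP hK ⁻¹' {t})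

theorem comulSpectrum_apply_eq_zero {f : Spectrum hP →ᵇ ℂ} {s t : Spectrum hP}
    (hf : ∀ x ∈ mulSet hP hK s t, f x = 0) : comulSpectrum hP hK hleft hright f (s, t) = 0 := by
  obtain ⟨p, rfl⟩ := proj_surjective hP hK s
  obtain ⟨q, rfl⟩ := proj_surjective hP hK t
  rw [comulSpectrum_apply_right]
  refine map_apply_eq_zero_of_forall_fibre hP hK fun x hx => hf _ ?_
  exact ⟨_, Set.mul_mem_mul rfl hx, rfl⟩

theorem comulSpectrum_nonneg {f : Spectrum hP →ᵇ ℂ} (h0 : ∀ x, 0 ≤ f x) (s t : Spectrum hP) :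
    0 ≤ comulSpectrum hP hK hleft hright f (s, t) := by
  obtain ⟨p, rfl⟩ := proj_surjective hP hK s
  obtain ⟨q, rfl⟩ := proj_surjective hP hK t
  rw [comulSpectrum_apply_right]
  exact hP.nonneg_of_nonneg _ (fun x => h0 _) q

/-- With `x = φ(p q)`, the averaged function `y ↦ f (φ(p y))` is positive at `q`. Together with
`comulSpectrum_apply_eq_zero` this makes `mulSet` the support of `ε_s * ε_t`. -/
theorem comulSpectrum_pos {f : Spectrum hP →ᵇ ℂ} (h0 : ∀ x, 0 ≤ f x) {s t x : Spectrum hP}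
    (hx : x ∈ mulSet hP hK s t) (hpos : 0 < f x) :
    0 < comulSpectrum hP hK hleft hright f (s, t) := by
  obtain ⟨_, ⟨p, rfl, q, rfl, rfl⟩, rfl⟩ := hx
  rw [comulSpectrum_apply_right]
  exact map_apply_pos hP hK (fun x => h0 _) rfl hpos

theorem comulSpectrum_one : comulSpectrum hP hK hleft hright 1 = 1 := by
  ext ⟨s, t⟩
  obtain ⟨p, rfl⟩ := proj_surjective hP hK s
  obtain ⟨q, rfl⟩ := proj_surjective hP hK t
  rw [comulSpectrum_apply_right]
  have : sectionRight (comul (lift hP hK 1)) p = 1 := rfl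
  rw [this, hK.map_one hP]
  rfl

theorem isCompact_preimage_mul_preimage {K L : Set (Spectrum hP)} (hKc : IsCompact K)
    (hLc : IsCompact L) : IsCompact (proj hP hK '' (proj hP hK ⁻¹' K * proj hP hK ⁻¹' L)) :=
  ((isCompact_preimage_proj hP hK hKc).mul (isCompact_preimage_proj hP hK hLc)).image
    (proj hP hK).continuous

theorem isCompact_mulSet (s t : Spectrum hP) : IsCompact (mulSet hP hK s t) :=
  isCompact_preimage_mul_preimage hP hK isCompact_singleton isCompact_singleton

theorem nonempty_mulSet (s t : Spectrum hP) : (mulSet hP hK s t).Nonempty := by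
  obtain ⟨p, rfl⟩ := proj_surjective hP hK s
  obtain ⟨q, rfl⟩ := proj_surjective hP hK t
  exact ⟨_, _, Set.mul_mem_mul rfl rfl, rfl⟩

/-- The hypotheses and idempotence give `(P × P) Δ (P h) = (P × P) Δ h`, so the inner average in `h
= f' (p ·)` can be dropped. Both sides are then `P × P` applied to `(y, z) ↦ f' (p y z)`. -/
theorem comulSpectrum_coassoc (f : Spectrum hP →ᵇ ℂ) (s t u : Spectrum hP) :
    comulSpectrum hP hK hleft hright
        (sectionLeft (comulSpectrum hP hK hleft hright f) u) (s, t)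
      = comulSpectrum hP hK hleft hright
        (sectionRight (comulSpectrum hP hK hleft hright f) s) (t, u) := by
  obtain ⟨p, rfl⟩ := proj_surjective hP hK s
  obtain ⟨q, rfl⟩ := proj_surjective hP hK t
  obtain ⟨r, rfl⟩ := proj_surjective hP hK u
  set f' := lift hP hK f with hf'
  have h1 : lift hP hK (sectionRight (comulSpectrum hP hK hleft hright f) (proj hP hK p))
      = P (sectionRight (comul f') p) := by
    ext y
    exact comulSpectrum_apply_right hP hK hleft hright f p y
  rw [comulSpectrum_apply_right, comulSpectrum_apply, h1, ← hright, hP.idem, hright]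
  change _ = P (sectionLeft (idTensor hP hK (comul (sectionRight (comul f') p))) r) q
  congr 2
  ext y
  change comulSpectrum hP hK hleft hright f (proj hP hK (p * y), proj hP hK r)
    = P (sectionRight (comul (sectionRight (comul f') p)) y) r
  rw [comulSpectrum_apply_right]
  congr 2
  ext z
  exact congrArg f' (mul_assoc p y z)

theorem isLocalComultiplication_comulSpectrum [LocallyCompactSpace (Spectrum hP)] :
    IsLocalComultiplication (comulSpectrum hP hK hleft hright) where
  norm_le f := (BoundedContinuousFunction.norm_le (norm_nonneg f)).2
    fun _ => norm_tensor_comul_lift_le hP hK hright f _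
  exists_isCompact K L hKc hLc := by
    refine ⟨_, isCompact_preimage_mul_preimage hP hK hKc hLc, fun f hf s hs t ht => ?_⟩
    refine comulSpectrum_apply_eq_zero hP hK hleft hright fun x hx => hf x ?_
    exact Set.image_mono (Set.mul_subset_mul (Set.preimage_mono (Set.singleton_subset_iff.2 hs))
      (Set.preimage_mono (Set.singleton_subset_iff.2 ht))) hx
  coassoc := comulSpectrum_coassoc hP hK hleft hright

end Comultiplication

end CondExpectation

/-- Outer regularity uses that `f` is closed: an open set containing `f ⁻¹' A` contains the preimage
of an open set around `A`. -/
theorem IsProperMap.regular_map {X Y : Type*} [TopologicalSpace X] [MeasurableSpace X]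
    [BorelSpace X] [TopologicalSpace Y] [T2Space Y] [MeasurableSpace Y] [BorelSpace Y]
    {f : X → Y} (hf : IsProperMap f) (m : Measure X) [m.Regular] : (m.map f).Regular where
  lt_top_of_isCompact K hK := by
    rw [Measure.map_apply hf.continuous.measurable hK.measurableSet]
    exact (hf.isCompact_preimage hK).measure_lt_top
  outerRegular A hA r hr := by
    rw [Measure.map_apply hf.continuous.measurable hA] at hr
    obtain ⟨U, hAU, hU, hUr⟩ := (f ⁻¹' A).exists_isOpen_lt_of_lt r hr
    have hV : IsOpen (f '' Uᶜ)ᶜ := (hf.isClosedMap _ hU.isClosed_compl).isOpen_compl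
    refine ⟨(f '' Uᶜ)ᶜ, ?_, hV, ?_⟩
    · rintro _ ha ⟨x, hx, rfl⟩
      exact hx (hAU ha)
    · rw [Measure.map_apply hf.continuous.measurable hV.measurableSet]
      refine (measure_mono fun x hx => ?_).trans_lt hUr
      by_contra hxU
      exact hx ⟨x, hxU, rfl⟩
  innerRegular U hU r hr := by
    rw [Measure.map_apply hf.continuous.measurable hU.measurableSet] at hr
    obtain ⟨K, hKU, hK, hrK⟩ := (hU.preimage hf.continuous).exists_lt_isCompact hr
    refine ⟨f '' K, Set.image_subset_iff.2 hKU, hK.image hf.continuous, ?_⟩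
    rw [Measure.map_apply hf.continuous.measurable (hK.image hf.continuous).measurableSet]
    exact hrK.trans_le (measure_mono (Set.subset_preimage_image f K))

namespace Hypergroup

theorem exists_nonneg_pos_of_mem_nhds {Q : Type*} [TopologicalSpace Q] [LocallyCompactSpace Q]
    [T2Space Q] {x : Q} {U : Set Q} (hU : U ∈ 𝓝 x) :
    ∃ f : C₀(Q, ℂ), (∀ y, 0 ≤ f y) ∧ (∀ y ∉ U, f y = 0) ∧ 0 < f x := by
  obtain ⟨f, h1, h0, hc, h01⟩ := exists_continuous_one_zero_of_isCompact
    (isCompact_singleton (x := x)) (isOpen_interior (s := U)).isClosed_compl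
    (Set.disjoint_singleton_left.2 fun h => h (mem_interior_iff_mem_nhds.2 hU))
  have hc' : HasCompactSupport fun x => ((f x : ℝ) : ℂ) :=
    hc.comp_left (g := fun r : ℝ => (r : ℂ)) (by simp)
  refine ⟨⟨⟨fun x => ((f x : ℝ) : ℂ), by fun_prop⟩, hc'.is_zero_at_infty⟩,
    fun y => Complex.zero_le_real.2 (h01 y).1, fun y hy => ?_, ?_⟩
  · change ((f y : ℝ) : ℂ) = 0
    rw [h0 fun h => hy (interior_subset h)]
    simp
  · change (0 : ℂ) < ((f x : ℝ) : ℂ)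
    rw [h1 rfl]
    simp

theorem mapHomeo_apply {Q : Type*} [TopologicalSpace Q] (σ : Q ≃ₜ Q) (μ : BoundedMeasure Q)
    (f : C₀(Q, ℂ)) : mapHomeo σ μ f = μ (f.comp σ.toCocompactMap) := rfl

end Hypergroup

namespace CondExpectation

/-! ### The hypergroup axioms and the Haar measure -/

section Hypergroup

open scoped Pointwise

variable {G : Type*} [TopologicalSpace G] [LocallyCompactSpace G] [T2Space G]
  [Group G] [IsTopologicalGroup G] {P : (G →ᵇ ℂ) →L[ℂ] (G →ᵇ ℂ)}
  (hP : IsConditionalExpectation P) (hK : PreservesCompactPositivity P)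
  (hleft : ∀ f, tensorId hP hK (comul (P f)) = idTensor hP hK (comul (P f)))
  (hright : ∀ f, idTensor hP hK (comul (P f)) = tensor hP hK (comul f))
  (hinv : ∀ f, P (check f) = check (P f))

theorem checkFun_proj (p : G) : checkFun hP hinv (proj hP hK p) = proj hP hK p⁻¹ :=
  WeakDual.CharacterSpace.ext fun _ => rfl

theorem comulSpectrum_proj_one_left (f : Spectrum hP →ᵇ ℂ) (s : Spectrum hP) :
    comulSpectrum hP hK hleft hright f (proj hP hK 1, s) = f s := by
  obtain ⟨q, rfl⟩ := proj_surjective hP hK s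
  rw [comulSpectrum_apply_right]
  have h : sectionRight (comul (lift hP hK f)) 1 = lift hP hK f := by
    ext y
    exact congrArg (lift hP hK f) (one_mul y)
  rw [h, map_lift]
  rfl

theorem comulSpectrum_proj_one_right (f : Spectrum hP →ᵇ ℂ) (s : Spectrum hP) :
    comulSpectrum hP hK hleft hright f (s, proj hP hK 1) = f s := by
  obtain ⟨p, rfl⟩ := proj_surjective hP hK s
  rw [comulSpectrum_apply_left]
  have h : sectionLeft (comul (lift hP hK f)) 1 = lift hP hK f := by
    ext y
    exact congrArg (lift hP hK f) (mul_one y)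
  rw [h, map_lift]
  rfl

/-- Inversion in `G` exchanges right and left sections, hence the two one-variable formulas for the
comultiplication. -/
theorem comulSpectrum_comp_check (f g : Spectrum hP →ᵇ ℂ)
    (h : ∀ s, g s = f (checkFun hP hinv s)) (s t : Spectrum hP) :
    comulSpectrum hP hK hleft hright g (s, t)
      = comulSpectrum hP hK hleft hright f (checkFun hP hinv t, checkFun hP hinv s) := by
  obtain ⟨p, rfl⟩ := proj_surjective hP hK s
  obtain ⟨q, rfl⟩ := proj_surjective hP hK t
  rw [checkFun_proj, checkFun_proj, comulSpectrum_apply_right, comulSpectrum_apply_left]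
  have e : sectionRight (comul (lift hP hK g)) p
      = check (sectionLeft (comul (lift hP hK f)) p⁻¹) := by
    ext y
    change g (proj hP hK (p * y)) = f (proj hP hK (y⁻¹ * p⁻¹))
    rw [h, checkFun_proj, mul_inv_rev]
  rw [e, hinv]
  rfl

include hleft hright in
-- A bump function at a point other than `s`, vanishing at `s`, would integrate positively against
-- `ε_ẽ * ε_s = ε_s`. In `G`: multiplying by the fibre of `ẽ` on the left preserves all fibres.
theorem mulSet_proj_one (s : Spectrum hP) : mulSet hP hK (proj hP hK 1) s ⊆ {s} := by
  have := locallyCompactSpace_spectrum hP hK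
  intro x hx
  by_contra hne
  obtain ⟨f, hf0, hf, hfx⟩ := exists_nonneg_pos_of_mem_nhds
    (isOpen_compl_singleton.mem_nhds (show x ∈ ({s} : Set (Spectrum hP))ᶜ from hne))
  have h1 := comulSpectrum_pos hP hK hleft hright (f := f.toBCF) hf0 hx hfx
  rw [comulSpectrum_proj_one_left] at h1
  exact h1.ne' (hf s fun h => h rfl)

include hleft hright in
theorem proj_one_mem_mulSet_iff (s t : Spectrum hP) :
    proj hP hK 1 ∈ mulSet hP hK s t ↔ s = checkFun hP hinv t := by
  constructor
  · rintro ⟨_, ⟨p, rfl, q, rfl, rfl⟩, h⟩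
    -- Write `p = (p q) q⁻¹` with `p q` in the fibre of `ẽ`.
    have h1 : proj hP hK p ∈ mulSet hP hK (proj hP hK 1) (proj hP hK q⁻¹) :=
      ⟨_, Set.mul_mem_mul h rfl, congrArg (proj hP hK) (mul_inv_cancel_right p q)⟩
    rw [checkFun_proj]
    exact mulSet_proj_one hP hK hleft hright _ h1
  · rintro rfl
    obtain ⟨q, rfl⟩ := proj_surjective hP hK t
    rw [checkFun_proj]
    exact ⟨_, Set.mul_mem_mul rfl rfl, congrArg (proj hP hK) (inv_mul_cancel q)⟩

/-- The tube lemma thickens the two compact fibres to open sets, and closedness of `φ` shrinks these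
to preimages of neighbourhoods. -/
theorem isOpen_setOf_mulSet_subset {U : Set (Spectrum hP)} (hU : IsOpen U) :
    IsOpen {z : Spectrum hP × Spectrum hP | mulSet hP hK z.1 z.2 ⊆ U} := by
  rw [isOpen_iff_mem_nhds]
  rintro ⟨s, t⟩ hst
  have hn : IsOpen ((fun z : G × G => z.1 * z.2) ⁻¹' (proj hP hK ⁻¹' U)) :=
    (hU.preimage (proj hP hK).continuous).preimage continuous_mul
  obtain ⟨A, B, hA, hB, hsA, htB, hAB⟩ := generalized_tube_lemma
    (isCompact_preimage_proj hP hK (isCompact_singleton (x := s)))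
    (isCompact_preimage_proj hP hK (isCompact_singleton (x := t))) hn
    fun z hz => hst ⟨_, Set.mul_mem_mul hz.1 hz.2, rfl⟩
  obtain ⟨V, hV, hVA⟩ := exists_mem_nhds_preimage_proj_subset hP hK hA hsA
  obtain ⟨W, hW, hWB⟩ := exists_mem_nhds_preimage_proj_subset hP hK hB htB
  refine mem_of_superset (prod_mem_nhds hV hW) ?_
  rintro ⟨s', t'⟩ ⟨hs', ht'⟩ _ ⟨_, ⟨p, rfl, q, rfl, rfl⟩, rfl⟩
  exact hAB (Set.mk_mem_prod (hVA hs') (hWB ht'))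

include hleft hright in
-- A bump function supported in `U` has a comultiplication that is nonzero at `(s, t)`, hence
-- nearby, and this forces the product sets to meet `U`.
theorem isOpen_setOf_mulSet_inter_nonempty {U : Set (Spectrum hP)} (hU : IsOpen U) :
    IsOpen {z : Spectrum hP × Spectrum hP | (mulSet hP hK z.1 z.2 ∩ U).Nonempty} := by
  have := locallyCompactSpace_spectrum hP hK
  rw [isOpen_iff_mem_nhds]
  rintro ⟨s, t⟩ ⟨x, hx, hxU⟩
  obtain ⟨f, hf0, hf, hfx⟩ := exists_nonneg_pos_of_mem_nhds (hU.mem_nhds hxU)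
  have h1 := (comulSpectrum_pos hP hK hleft hright (f := f.toBCF) hf0 hx hfx).ne'
  filter_upwards [(comulSpectrum hP hK hleft hright f.toBCF).continuous.continuousAt.eventually_ne
    h1] with z hz
  by_contra hne
  refine hz (comulSpectrum_apply_eq_zero hP hK hleft hright fun y hy => hf y fun hyU => ?_)
  exact hne ⟨y, hy, hyU⟩

/-- The product of two points of `Q` as a nonempty compact set. -/
def mulCompacts (z : Spectrum hP × Spectrum hP) :
    TopologicalSpace.NonemptyCompacts (Spectrum hP) :=
  ⟨⟨mulSet hP hK z.1 z.2, isCompact_mulSet hP hK z.1 z.2⟩, nonempty_mulSet hP hK z.1 z.2⟩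

include hleft hright in
theorem continuous_mulCompacts : Continuous (mulCompacts hP hK) := by
  let _ : TopologicalSpace (Set (Spectrum hP)) := TopologicalSpace.vietoris _
  rw [TopologicalSpace.NonemptyCompacts.isEmbedding_coe.continuous_iff]
  refine continuous_generateFrom_iff.2 ?_
  rintro _ (⟨U, hU, rfl⟩ | ⟨U, hU, rfl⟩)
  · exact isOpen_setOf_mulSet_subset hP hK hU
  · exact isOpen_setOf_mulSet_inter_nonempty hP hK hleft hright hU

variable [LocallyCompactSpace (Spectrum hP)]

/-- The convolution of bounded measures on `Q`. -/
def convolution : BoundedMeasure (Spectrum hP) →ₗ[ℂ] BoundedMeasure (Spectrum hP) →ₗ[ℂ]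
    BoundedMeasure (Spectrum hP) :=
  (isLocalComultiplication_comulSpectrum hP hK hleft hright).mul

theorem convolution_dirac_apply (s t : Spectrum hP) (f : C₀(Spectrum hP, ℂ)) :
    convolution hP hK hleft hright (dirac s) (dirac t) f
      = comulSpectrum hP hK hleft hright f.toBCF (s, t) :=
  (isLocalComultiplication_comulSpectrum hP hK hleft hright).mul_dirac_apply s t f

theorem supp_convolution_dirac (s t : Spectrum hP) :
    supp (convolution hP hK hleft hright (dirac s) (dirac t)) = mulSet hP hK s t := by
  ext x
  constructor
  · intro hx
    by_contra hne
    obtain ⟨f, hf, hne'⟩ := hx _ ((isCompact_mulSet hP hK s t).isClosed.isOpen_compl.mem_nhds hne)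
    rw [convolution_dirac_apply] at hne'
    exact hne' (comulSpectrum_apply_eq_zero hP hK hleft hright fun y hy => hf y fun h => h hy)
  · intro hx U hU
    obtain ⟨f, hf0, hf, hfx⟩ := exists_nonneg_pos_of_mem_nhds hU
    refine ⟨f, hf, ?_⟩
    rw [convolution_dirac_apply]
    exact (comulSpectrum_pos hP hK hleft hright (f := f.toBCF) hf0 hx hfx).ne'

theorem isProbability_convolution_dirac (s t : Spectrum hP) :
    IsProbability (convolution hP hK hleft hright (dirac s) (dirac t)) := by
  refine ⟨fun f hf => ?_, le_antisymm ?_ ?_⟩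
  · rw [convolution_dirac_apply]
    exact comulSpectrum_nonneg hP hK hleft hright (f := f.toBCF) hf s t
  · refine ContinuousLinearMap.opNorm_le_bound _ zero_le_one fun f => ?_
    rw [convolution_dirac_apply, one_mul]
    exact (BoundedContinuousFunction.norm_coe_le_norm _ _).trans
      ((isLocalComultiplication_comulSpectrum hP hK hleft hright).norm_le f.toBCF)
  -- The constant `1` need not lie in `C₀(Q)`; a cutoff equal to one on the support has the same
  -- integral.
  · obtain ⟨χ, hχ, -⟩ := exists_hasCompactSupport_mem_cutoffSet (isCompact_mulSet hP hK s t)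
    have h1 : convolution hP hK hleft hright (dirac s) (dirac t) χ = 1 := by
      rw [convolution_dirac_apply]
      have h2 := comulSpectrum_apply_eq_zero hP hK hleft hright (f := χ.toBCF - 1) (s := s)
        (t := t) fun x hx => by
          change χ x - 1 = 0
          rw [hχ.2 x hx, sub_self]
      rw [map_sub, comulSpectrum_one] at h2
      exact sub_eq_zero.1 h2
    have h2 := (convolution hP hK hleft hright (dirac s) (dirac t)).le_opNorm χ
    rw [h1, norm_one] at h2
    refine h2.trans (mul_le_of_le_one_right (norm_nonneg _) ?_)
    exact norm_le_of_forall_norm_le zero_le_one (norm_le_one_of_mem_cutoffSet hχ)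

theorem isHypergroup_convolution :
    IsHypergroup (convolution hP hK hleft hright) (proj hP hK 1) (checkHomeo hP hinv) where
  locallyCompact := inferInstance
  hausdorff := inferInstance
  assoc := (isLocalComultiplication_comulSpectrum hP hK hleft hright).mul_assoc
  isProbability := isProbability_convolution_dirac hP hK hleft hright
  continuous_mul f := by
    simp only [convolution_dirac_apply]
    exact (comulSpectrum hP hK hleft hright f.toBCF).continuous
  continuous_supp := ⟨mulCompacts hP hK,
    fun s t => (supp_convolution_dirac hP hK hleft hright s t).symm,
    continuous_mulCompacts hP hK hleft hright⟩
  one_mul s := by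
    ext f
    rw [convolution_dirac_apply, comulSpectrum_proj_one_left]
    rfl
  mul_one s := by
    ext f
    rw [convolution_dirac_apply, comulSpectrum_proj_one_right]
    rfl
  inv_inv := checkFun_checkFun hP hinv
  map_inv s t := by
    ext f
    rw [mapHomeo_apply, convolution_dirac_apply, convolution_dirac_apply]
    exact comulSpectrum_comp_check hP hK hleft hright hinv _ _ (fun _ => rfl) s t
  mem_supp_iff s t := by
    rw [supp_convolution_dirac]
    exact proj_one_mem_mulSet_iff hP hK hleft hright hinv s t

/-- Pulled back to `G`, the integral is `∫ P (f ∘ φ ∘ (p ·)) dm`. Invariance of `m` under `P`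
removes `P`, and left invariance removes `p`. -/
theorem isLeftHaarMeasure_map_proj [MeasurableSpace G] [BorelSpace G] (m : Measure G)
    [m.IsHaarMeasure] [m.Regular]
    (hm : ∀ f : G →ᵇ ℂ, HasCompactSupport f → ∫ p, P f p ∂m = ∫ p, f p ∂m) :
    IsLeftHaarMeasure (convolution hP hK hleft hright) (m.map (proj hP hK)) := by
  have hmeas : Measurable (proj hP hK) := (proj hP hK).continuous.measurable
  have hreg := (isProperMap_proj hP hK).regular_map m
  refine ⟨hreg, ?_, fun s f hf => ?_⟩
  · rw [Ne, Measure.map_eq_zero_iff hmeas.aemeasurable]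
    exact NeZero.ne m
  · obtain ⟨p, rfl⟩ := proj_surjective hP hK s
    simp only [convolution_dirac_apply]
    set h := sectionRight (comul (lift hP hK f.toBCF)) p with hh
    have hc : HasCompactSupport h := by
      have h1 : HasCompactSupport (lift hP hK f.toBCF) :=
        HasCompactSupport.intro (isCompact_preimage_proj hP hK hf)
          fun x hx => image_eq_zero_of_notMem_tsupport (f := f) hx
      exact h1.comp_homeomorph (Homeomorph.mulLeft p)
    have hPc := hK.hasCompactSupport_map hP hc
    have hcD : HasCompactSupport fun t =>
        comulSpectrum hP hK hleft hright f.toBCF (proj hP hK p, t) := by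
      refine HasCompactSupport.intro (hPc.image (proj hP hK).continuous) fun t ht => ?_
      obtain ⟨q, rfl⟩ := proj_surjective hP hK t
      rw [comulSpectrum_apply_right]
      exact image_eq_zero_of_notMem_tsupport fun hq => ht ⟨q, hq, rfl⟩
    have hint : Integrable (fun t =>
        comulSpectrum hP hK hleft hright f.toBCF (proj hP hK p, t)) (m.map (proj hP hK)) :=
      Continuous.integrable_of_hasCompactSupport (by fun_prop) hcD
    have hfint : Integrable (fun t => f t) (m.map (proj hP hK)) :=
      Continuous.integrable_of_hasCompactSupport f.continuous hf
    refine ⟨hint, ?_⟩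
    rw [integral_map hmeas.aemeasurable hint.aestronglyMeasurable,
      integral_map hmeas.aemeasurable hfint.aestronglyMeasurable]
    simp only [comulSpectrum_apply_right]
    rw [hm h hc]
    exact integral_mul_left_eq_self (fun x => f (proj hP hK x)) p

end Hypergroup

end CondExpectation
end

theorem mainTheorem3 {G : Type*} [Group G] [TopologicalSpace G] [IsTopologicalGroup G]
    [LocallyCompactSpace G] [T2Space G]
    (P : (G →ᵇ ℂ) →L[ℂ] (G →ᵇ ℂ))
    (hP : IsConditionalExpectation P) (hK : PreservesCompactPositivity P)
    (hleft : ∀ f, tensorId hP hK (comul (P f)) = idTensor hP hK (comul (P f)))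
    (hright : ∀ f, idTensor hP hK (comul (P f)) = tensor hP hK (comul f))
    (hinv : ∀ f, P (check f) = check (P f)) :
    Function.Surjective (proj hP hK) ∧
    ∃ (D : (Spectrum hP →ᵇ ℂ) →ₗ[ℂ] (Spectrum hP × Spectrum hP →ᵇ ℂ))
      (mul : BoundedMeasure (Spectrum hP) →ₗ[ℂ]
        BoundedMeasure (Spectrum hP) →ₗ[ℂ] BoundedMeasure (Spectrum hP)),
      (∀ (f : Spectrum hP →ᵇ ℂ) (p q : G),
        D f (proj hP hK p, proj hP hK q)
          = tensor hP hK (comul (f.compContinuous (proj hP hK))) (p, q)) ∧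
      IsHypergroup mul (proj hP hK 1) (checkHomeo hP hinv) ∧
      IsComultiplication mul D ∧
      ∀ [MeasurableSpace G] [BorelSpace G] (m : Measure G) [m.IsHaarMeasure] [m.Regular],
        (∀ f : G →ᵇ ℂ, HasCompactSupport f → ∫ p, P f p ∂m = ∫ p, f p ∂m) →
          IsLeftHaarMeasure mul (m.map (proj hP hK)) := by
  have := locallyCompactSpace_spectrum hP hK
  refine ⟨proj_surjective hP hK, comulSpectrum hP hK hleft hright,
    convolution hP hK hleft hright, comulSpectrum_apply hP hK hleft hright,
    isHypergroup_convolution hP hK hleft hright hinv,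
    (isLocalComultiplication_comulSpectrum hP hK hleft hright).isComultiplication_mul, ?_⟩
  intro _ _ m _ _ hm
  exact isLeftHaarMeasure_map_proj hP hK hleft hright m hm
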